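/- **Setting.** Let $M\ge 0$ be the number of modes and let $\mathcal H$ be the bosonic Fock space of $M$ modes, with orthonormal basis of number states $|n\rangle$, $n=(n_1,\dots,n_M)\in\mathbb Z_{\ge 0}^M$. Let $a_m|n\rangle=\sqrt{n_m}\,|n-\delta_m\rangle$ and $a_m^\dagger|n\rangle=\sqrt{n_m+1}\,|n+\delta_m\rangle$ (where $\delta_m$ is the $m$-th unit vector) be the annihilation and creation operators. For $\alpha\in\mathbb C^M$ let $$D(\alpha)=\exp\Big(\sum_{m=1}^M(\alpha_m a_m^\dagger-\overline{\alpha_m}\,a_m)\Big),\qquad \Pi=\exp\Big(-i\pi\sum_{m=1}^M a_m^\dagger a_m\Big),\qquad \Pi(\alpha)=D(\alpha)\,\Pi\,D(\alpha)^\dagger$$ be the displacement operators, the parity operator and the displaced parity operators, which are bounded operators on $\mathcal H$. For a matrix $A$, let $\|A\|_1$ be its trace norm, the sum of its singular values. **Proposition (Bochner's theorem and bounds of absolute volume of displaced parity).** Let $R=R^\dagger$ be a self-adjoint trace-class operator on $\mathcal H$, i.e. $\operatorname{tr}|R|<\infty$, and let $\Xi=\{\xi_n\}_{n=1}^N$ be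 any finite family of points of $\mathbb C^M$. Let $C(R;\Xi)\in\mathbb C^{N\times N}$ be the matrix with entries $$[C(R;\Xi)]_{n,n'}=\frac1N\operatorname{tr}\big[R\,D(\xi_n-\xi_{n'})\big].$$ Then $$\|C(R;\Xi)\|_1\;\le\;\Big(\frac{2}{\pi}\Big)^{M}\int_{\mathbb C^M}\big|\operatorname{tr}[R\,\Pi(\alpha)]\big|\,d^{2M}\alpha ,$$ where $d^{2M}\alpha=\prod_m d\operatorname{Re}\alpha_m\,d\operatorname{Im}\alpha_m$ is Lebesgue measure on $\mathbb C^M\cong\mathbb R^{2M}$ and the right-hand side is $+\infty$ if the integral diverges. -/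

import Mathlib

open scoped ComplexConjugate InnerProductSpace

namespace BosonicModes

noncomputable section

/-! ## Trace-class operators and the trace -/

section TraceClass

/-- The absolute value `|T| = (T† T)^{1/2}` of a bounded operator on a complex Hilbert space. -/
def absOp {H : Type*} [NormedAddCommGroup H] [InnerProductSpace ℂ H] [CompleteSpace H]
    (T : H →L[ℂ] H) : H →L[ℂ] H :=
  CFC.abs T

/-- `T` is trace class: `‖T‖₁ = tr |T| = ∑ᵢ ⟨bᵢ, |T| bᵢ⟩ < ∞`. As `|T|` is positive, this does not
depend on the orthonormal basis `b`. -/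
def IsTraceClass {ι H : Type*} [NormedAddCommGroup H] [InnerProductSpace ℂ H] [CompleteSpace H]
    (b : HilbertBasis ι ℂ H) (T : H →L[ℂ] H) : Prop :=
  Summable fun i => (⟪b i, absOp T (b i)⟫_ℂ).re

/-- The trace `tr T = ∑ᵢ ⟨bᵢ, T bᵢ⟩`. For trace-class `T` the series converges absolutely and its
sum does not depend on the orthonormal basis `b`. -/
def trace {ι H : Type*} [NormedAddCommGroup H] [InnerProductSpace ℂ H]
    (b : HilbertBasis ι ℂ H) (T : H →L[ℂ] H) : ℂ :=
  ∑' i, ⟪b i, T (b i)⟫_ℂ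

/-- The trace norm of a complex square matrix: the sum of its singular values. -/
def matrixTraceNorm {N : ℕ} (A : Matrix (Fin N) (Fin N) ℂ) : ℝ :=
  ∑ i : Fin N, (Matrix.toEuclideanLin A).singularValues i

end TraceClass

/-! ## Fock space of `M` modes, ladder operators -/

/-- The Hilbert space of `M` modes, `ℓ²` over the occupation numbers `n = (n₁, …, n_M)`. -/
abbrev FockSpace (M : ℕ) : Type := lp (fun _ : Fin M → ℕ => ℂ) 2

/-- The orthonormal basis of number states `|n⟩`. -/
def numberBasis (M : ℕ) : HilbertBasis (Fin M → ℕ) ℂ (FockSpace M) :=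
  HilbertBasis.ofRepr (LinearIsometryEquiv.refl ℂ (FockSpace M))

/-- Finite linear combinations of number states: a common invariant dense domain of the
(unbounded) ladder operators. -/
abbrev FiniteVec (M : ℕ) : Type := (Fin M → ℕ) →₀ ℂ

/-- The inclusion of the finite vectors into Fock space. -/
def embed (M : ℕ) : FiniteVec M →ₗ[ℂ] FockSpace M :=
  Finsupp.linearCombination ℂ (numberBasis M)

/-- The creation operator of mode `m`: `a_m† |n⟩ = √(n_m + 1) |n + δ_m⟩`. -/
def creation {M : ℕ} (m : Fin M) : FiniteVec M →ₗ[ℂ] FiniteVec M :=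
  Finsupp.linearCombination ℂ fun n =>
    Finsupp.single (Function.update n m (n m + 1)) ((Real.sqrt ((n m : ℝ) + 1) : ℝ) : ℂ)

/-- The annihilation operator of mode `m`: `a_m |n⟩ = √(n_m) |n - δ_m⟩` (which is `0` if
`n_m = 0`). -/
def annihilation {M : ℕ} (m : Fin M) : FiniteVec M →ₗ[ℂ] FiniteVec M :=
  Finsupp.linearCombination ℂ fun n =>
    Finsupp.single (Function.update n m (n m - 1)) ((Real.sqrt (n m : ℝ) : ℝ) : ℂ)

/-- `α ∧ a = ∑_m (α_m a_m† - α_m^* a_m)`. -/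
def displacementGenerator {M : ℕ} (α : Fin M → ℂ) : FiniteVec M →ₗ[ℂ] FiniteVec M :=
  ∑ m, (α m • creation m - conj (α m) • annihilation m)

/-- `-iπ ∑_m a_m† a_m`. -/
def parityGenerator (M : ℕ) : FiniteVec M →ₗ[ℂ] FiniteVec M :=
  (-(Complex.I * (Real.pi : ℂ))) • ∑ m : Fin M, creation m ∘ₗ annihilation m

/-! ## Exponentials -/

/-- `T` is the exponential `e^A` of the operator `A` defined on finite vectors: `T` is bounded and
`T v = ∑_k A^k v / k!` (norm-convergent) for every finite vector `v`. -/
def IsExp {M : ℕ} (A : FiniteVec M →ₗ[ℂ] FiniteVec M) (T : FockSpace M →L[ℂ] FockSpace M) :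
    Prop :=
  ∀ v : FiniteVec M,
    HasSum (fun k : ℕ => ((Nat.factorial k : ℂ)⁻¹) • embed M ((A ^ k) v)) (T (embed M v))

theorem numberBasis_apply {M : ℕ} (n : Fin M → ℕ) :
    numberBasis M n = lp.single 2 n (1 : ℂ) := by
  have := (numberBasis M).repr_symm_single n
  rw [← this]; rfl

theorem embed_single {M : ℕ} (n : Fin M → ℕ) (c : ℂ) :
    embed M (Finsupp.single n c) = c • numberBasis M n := by
  simp [embed]

theorem norm_embed_single {M : ℕ} (n : Fin M → ℕ) (c : ℂ) :
    ‖embed M (Finsupp.single n c)‖ = ‖c‖ := by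
  rw [embed_single, norm_smul, (numberBasis M).orthonormal.1 n, mul_one]

theorem denseRange_embed (M : ℕ) : DenseRange (embed M) := by
  have h := (numberBasis M).dense_span
  rw [← Finsupp.range_linearCombination] at h
  have h2 : Dense ((LinearMap.range (embed M) : Submodule ℂ (FockSpace M)) : Set (FockSpace M)) :=
    Submodule.dense_iff_topologicalClosure_eq_top.2 h
  rw [LinearMap.coe_range] at h2
  exact h2

/-- A skew-symmetric operator on finite vectors whose exponential series converges absolutely
there has a unique bounded exponential. -/
theorem existsUnique_isExp {M : ℕ} (A : FiniteVec M →ₗ[ℂ] FiniteVec M)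
    (hskew : ∀ u v, ⟪embed M (A u), embed M v⟫_ℂ = -⟪embed M u, embed M (A v)⟫_ℂ)
    (hsum : ∀ n : Fin M → ℕ,
      Summable fun k : ℕ => ((Nat.factorial k : ℝ)⁻¹) * ‖embed M ((A ^ k) (Finsupp.single n 1))‖) :
    ∃! T : FockSpace M →L[ℂ] FockSpace M, IsExp A T := by
  have hsum' : ∀ v : FiniteVec M,
      Summable fun k : ℕ => ‖((Nat.factorial k : ℂ)⁻¹) • embed M ((A ^ k) v)‖ := by
    intro v
    induction v using Finsupp.induction_linear with
    | zero => simp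
    | add u v hu hv =>
      refine Summable.of_nonneg_of_le (fun _ => norm_nonneg _) (fun k => ?_) (hu.add hv)
      rw [map_add, map_add, smul_add]
      exact norm_add_le _ _
    | single n c =>
      refine ((hsum n).mul_left ‖c‖).congr fun k => ?_
      have : (Finsupp.single n c : FiniteVec M) = c • Finsupp.single n 1 := by simp
      rw [this, map_smul, map_smul, norm_smul, norm_smul]
      simp
      ring
  let S : FiniteVec M →ₗ[ℂ] FockSpace M :=
    { toFun := fun v => ∑' k : ℕ, ((Nat.factorial k : ℂ)⁻¹) • embed M ((A ^ k) v)
      map_add' := by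
        intro u v
        rw [← (hsum' u).of_norm.tsum_add (hsum' v).of_norm]
        simp [smul_add]
      map_smul' := by
        intro c v
        rw [RingHom.id_apply, ← (hsum' v).of_norm.tsum_const_smul]
        exact tsum_congr fun k => by rw [map_smul, map_smul, smul_comm] }
  have hS : ∀ v, HasSum (fun k : ℕ => ((Nat.factorial k : ℂ)⁻¹) • embed M ((A ^ k) v)) (S v) :=
    fun v => (hsum' v).of_norm.hasSum
  have hskewk : ∀ (k : ℕ) (u v : FiniteVec M),
      ⟪embed M ((A ^ k) u), embed M v⟫_ℂ = (-1) ^ k * ⟪embed M u, embed M ((A ^ k) v)⟫_ℂ := by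
    intro k
    induction k with
    | zero => intro u v; simp
    | succ k ih =>
      intro u v
      rw [pow_succ', Module.End.mul_apply, hskew, ih, ← Module.End.mul_apply, ← pow_succ, pow_succ',
        pow_succ]
      ring
  have hiso : ∀ v, ⟪S v, S v⟫_ℂ = ⟪embed M v, embed M v⟫_ℂ := by
    intro v
    set f : ℕ → FockSpace M := fun k => ((Nat.factorial k : ℂ)⁻¹) • embed M ((A ^ k) v) with hf
    have hF : Summable fun p : ℕ × ℕ => ⟪f p.1, f p.2⟫_ℂ := by
      refine Summable.of_norm_bounded
        ((hsum' v).mul_of_nonneg (hsum' v) (fun _ => norm_nonneg _) (fun _ => norm_nonneg _)) ?_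
      exact fun p => norm_inner_le_norm _ _
    have h1 : ∑' p : ℕ × ℕ, ⟪f p.1, f p.2⟫_ℂ = ⟪S v, S v⟫_ℂ := by
      rw [hF.tsum_prod]
      have h2 : ∀ i, ∑' j, ⟪f i, f j⟫_ℂ = ⟪f i, S v⟫_ℂ := fun i =>
        ((hS v).mapL (innerSL ℂ (f i))).tsum_eq
      simp_rw [h2]
      have h3 := ((hS v).mapL (innerSL ℂ (S v)))
      have h4 := (Complex.hasSum_conj'.2 h3).tsum_eq
      simpa [hf, inner_conj_symm, mul_comm] using h4
    have hF' := Finset.HasAntidiagonal.sigmaAntidiagonalEquivProd.summable_iff.2 hF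
    rw [← h1, ← Finset.HasAntidiagonal.sigmaAntidiagonalEquivProd.tsum_eq
      (fun p : ℕ × ℕ => ⟪f p.1, f p.2⟫_ℂ)]
    refine (Summable.tsum_sigma' (fun n => (hasSum_fintype _).summable) hF').trans ?_
    have h5 : ∀ n : ℕ, (∑' p : Finset.HasAntidiagonal.antidiagonal n,
        ⟪f (p : ℕ × ℕ).1, f (p : ℕ × ℕ).2⟫_ℂ) =
        if n = 0 then ⟪embed M v, embed M v⟫_ℂ else 0 := by
      intro n
      rw [tsum_fintype, Finset.univ_eq_attach,
        Finset.sum_attach (Finset.HasAntidiagonal.antidiagonal n) fun p => ⟪f p.1, f p.2⟫_ℂ]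
      have h6 : ∀ p ∈ Finset.HasAntidiagonal.antidiagonal n, ⟪f p.1, f p.2⟫_ℂ =
          (n.choose p.1 • ((-1 : ℂ) ^ p.1 * 1 ^ p.2)) *
            ((Nat.factorial n : ℂ)⁻¹ * ⟪embed M v, embed M ((A ^ n) v)⟫_ℂ) := by
        rintro ⟨i, j⟩ hp
        obtain rfl : i + j = n := by simpa using hp
        simp only [hf, inner_smul_left, inner_smul_right, hskewk, map_inv₀, Complex.conj_natCast,
          ← Module.End.mul_apply, ← pow_add, one_pow, mul_one, nsmul_eq_mul]
        have h7 : ((i + j).choose i : ℂ) * (i.factorial : ℂ) * (j.factorial : ℂ)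
            = ((i + j).factorial : ℂ) := by
          have h := Nat.add_choose_mul_factorial_mul_factorial j i
          rw [add_comm j i] at h
          rw [mul_right_comm]
          exact_mod_cast h
        have hi : (i.factorial : ℂ) ≠ 0 := by exact_mod_cast i.factorial_ne_zero
        have hj : (j.factorial : ℂ) ≠ 0 := by exact_mod_cast j.factorial_ne_zero
        have hij : ((i + j).factorial : ℂ) ≠ 0 := by exact_mod_cast (i + j).factorial_ne_zero
        have h8 : ((i + j).choose i : ℂ) * ((i + j).factorial : ℂ)⁻¹
            = (i.factorial : ℂ)⁻¹ * (j.factorial : ℂ)⁻¹ := by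
          rw [← div_eq_mul_inv, div_eq_iff hij, ← h7]
          field_simp
        linear_combination (-(-1 : ℂ) ^ i * ⟪embed M v, embed M ((A ^ (i + j)) v)⟫_ℂ) * h8
      rw [Finset.sum_congr rfl h6, ← Finset.sum_mul, ← (Commute.all (-1 : ℂ) 1).add_pow']
      rcases Nat.eq_zero_or_pos n with rfl | hn
      · simp
      · simp [hn.ne']
    refine (tsum_congr h5).trans ?_
    rw [tsum_ite_eq]
  have hnorm : ∀ v, ‖S v‖ ≤ 1 * ‖embed M v‖ := by
    intro v
    have h := hiso v
    rw [inner_self_eq_norm_sq_to_K, inner_self_eq_norm_sq_to_K] at h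
    have h' : ‖S v‖ ^ 2 = ‖embed M v‖ ^ 2 := by exact_mod_cast h
    rw [one_mul]
    exact (sq_le_sq₀ (norm_nonneg _) (norm_nonneg _)).1 h'.le
  refine ⟨S.extendOfNorm (embed M), fun v => ?_, fun T hT => ?_⟩
  · rw [LinearMap.extendOfNorm_eq (denseRange_embed M) ⟨1, hnorm⟩]
    exact hS v
  · have hfun : (T : FockSpace M → FockSpace M) = S.extendOfNorm (embed M) := by
      refine (denseRange_embed M).equalizer T.continuous
        (S.extendOfNorm (embed M)).continuous ?_
      funext v
      simp only [Function.comp_apply]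
      rw [LinearMap.extendOfNorm_eq (denseRange_embed M) ⟨1, hnorm⟩]
      exact (hT v).unique (hS v)
    exact DFunLike.coe_injective hfun

theorem inner_creation {M : ℕ} (m : Fin M) (u v : FiniteVec M) :
    ⟪embed M (creation m u), embed M v⟫_ℂ = ⟪embed M u, embed M (annihilation m v)⟫_ℂ := by
  induction u using Finsupp.induction_linear with
  | zero => simp
  | add u u' hu hu' => simp only [map_add, inner_add_left, hu, hu']
  | single n c =>
    induction v using Finsupp.induction_linear with
    | zero => simp
    | add v v' hv hv' => simp only [map_add, inner_add_right, hv, hv']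
    | single n' c' =>
      have ho := orthonormal_iff_ite.1 (numberBasis M).orthonormal
      simp only [creation, annihilation, Finsupp.linearCombination_single, Finsupp.smul_single,
        embed_single, inner_smul_left, inner_smul_right, ho, smul_eq_mul, map_mul,
        Complex.conj_ofReal]
      by_cases h : Function.update n m (n m + 1) = n'
      · subst h
        simp
        ring
      · by_cases h0 : n' m = 0
        · simp [h, h0]
        · have : n ≠ Function.update n' m (n' m - 1) := by
            rintro rfl
            apply h
            simp [Nat.sub_add_cancel (Nat.one_le_iff_ne_zero.2 h0)]
          simp [h, this]

theorem inner_annihilation {M : ℕ} (m : Fin M) (u v : FiniteVec M) :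
    ⟪embed M (annihilation m u), embed M v⟫_ℂ = ⟪embed M u, embed M (creation m v)⟫_ℂ := by
  rw [← inner_conj_symm, ← inner_creation, inner_conj_symm]

theorem norm_displacementGenerator_pow_le {M : ℕ} (α : Fin M → ℂ) (k : ℕ) :
    ∀ (s : ℕ) (n : Fin M → ℕ), (∀ m, n m ≤ s) →
      ‖embed M ((displacementGenerator α ^ k) (Finsupp.single n 1))‖ ≤
        ∏ j ∈ Finset.range k, ((∑ m, 2 * ‖α m‖) * Real.sqrt ((s : ℝ) + 1 + j)) := by
  induction k with
  | zero => intro s n _; simp [norm_embed_single]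
  | succ k ih =>
    intro s n hn
    have e : (displacementGenerator α ^ (k + 1)) (Finsupp.single n 1) =
        ∑ m, ((α m * (Real.sqrt ((n m : ℝ) + 1) : ℝ)) • (displacementGenerator α ^ k)
            (Finsupp.single (Function.update n m (n m + 1)) 1)
          - (conj (α m) * (Real.sqrt (n m : ℝ) : ℝ)) • (displacementGenerator α ^ k)
            (Finsupp.single (Function.update n m (n m - 1)) 1)) := by
      have e1 : displacementGenerator α (Finsupp.single n 1) =
          ∑ m, ((α m * (Real.sqrt ((n m : ℝ) + 1) : ℝ)) •
              Finsupp.single (Function.update n m (n m + 1)) (1 : ℂ)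
            - (conj (α m) * (Real.sqrt (n m : ℝ) : ℝ)) •
              Finsupp.single (Function.update n m (n m - 1)) (1 : ℂ)) := by
        simp only [displacementGenerator, LinearMap.sum_apply, LinearMap.sub_apply,
          LinearMap.smul_apply, creation, annihilation, Finsupp.linearCombination_single, one_smul,
          Finsupp.smul_single, smul_eq_mul, mul_one]
      rw [pow_succ, Module.End.mul_apply, e1]
      simp only [map_sum, map_sub, map_smul]
    set P : ℝ := ∏ j ∈ Finset.range k,
      ((∑ m, 2 * ‖α m‖) * Real.sqrt (((s + 1 : ℕ) : ℝ) + 1 + j)) with hP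
    have hP0 : 0 ≤ P := Finset.prod_nonneg fun j _ => by positivity
    have hb : ∀ m, ‖embed M ((α m * (Real.sqrt ((n m : ℝ) + 1) : ℝ)) •
            (displacementGenerator α ^ k) (Finsupp.single (Function.update n m (n m + 1)) 1)
          - (conj (α m) * (Real.sqrt (n m : ℝ) : ℝ)) • (displacementGenerator α ^ k)
            (Finsupp.single (Function.update n m (n m - 1)) 1))‖ ≤
        2 * ‖α m‖ * (Real.sqrt ((s : ℝ) + 1) * P) := by
      intro m
      have hm : (n m : ℝ) ≤ s := by exact_mod_cast hn m
      have u1 := ih (s + 1) (Function.update n m (n m + 1)) (by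
        intro i
        by_cases hi : i = m
        · subst hi; simpa using hn i
        · simpa [hi] using (hn i).trans (Nat.le_succ s))
      have u2 := ih (s + 1) (Function.update n m (n m - 1)) (by
        intro i
        by_cases hi : i = m
        · subst hi; simpa using (hn i).trans (by omega)
        · simpa [hi] using (hn i).trans (Nat.le_succ s))
      have s1 : Real.sqrt ((n m : ℝ) + 1) ≤ Real.sqrt ((s : ℝ) + 1) :=
        Real.sqrt_le_sqrt (by linarith)
      have s2 : Real.sqrt (n m : ℝ) ≤ Real.sqrt ((s : ℝ) + 1) :=
        Real.sqrt_le_sqrt (by linarith)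
      rw [map_sub, map_smul, map_smul]
      refine (norm_sub_le _ _).trans ?_
      rw [norm_smul, norm_smul, norm_mul, norm_mul, RCLike.norm_conj, Complex.norm_real,
        Complex.norm_real, Real.norm_of_nonneg (Real.sqrt_nonneg _),
        Real.norm_of_nonneg (Real.sqrt_nonneg _), mul_assoc, mul_assoc, mul_assoc, two_mul]
      rw [← mul_add, ← mul_add]
      refine mul_le_mul_of_nonneg_left ?_ (norm_nonneg (α m))
      exact add_le_add (mul_le_mul s1 u1 (norm_nonneg _) (Real.sqrt_nonneg _))
        (mul_le_mul s2 u2 (norm_nonneg _) (Real.sqrt_nonneg _))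
    rw [e, map_sum]
    refine (norm_sum_le _ _).trans ((Finset.sum_le_sum fun m _ => hb m).trans (le_of_eq ?_))
    rw [← Finset.sum_mul, Finset.prod_range_succ', hP]
    have : ∀ j : ℕ, (s : ℝ) + 1 + ((j + 1 : ℕ) : ℝ) = ((s + 1 : ℕ) : ℝ) + 1 + j := by
      intro j; push_cast; ring
    simp_rw [this]
    simp
    ring

theorem existsUnique_displacement {M : ℕ} (α : Fin M → ℂ) :
    ∃! T : FockSpace M →L[ℂ] FockSpace M, IsExp (displacementGenerator α) T := by
  refine existsUnique_isExp _ (fun u v => ?_) (fun n => ?_)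
  · simp only [displacementGenerator, LinearMap.sum_apply, LinearMap.sub_apply,
      LinearMap.smul_apply, map_sum, map_sub, map_smul, sum_inner, inner_sum, inner_sub_left,
      inner_sub_right, inner_smul_left, inner_smul_right, inner_creation, inner_annihilation,
      Complex.conj_conj, ← Finset.sum_neg_distrib, neg_sub]
  · set B : ℝ := ∑ m, 2 * ‖α m‖ with hB
    have hB0 : 0 ≤ B := by positivity
    set s : ℕ := ∑ m, n m with hs
    have hle : ∀ m, n m ≤ s := fun m =>
      Finset.single_le_sum (f := n) (fun i _ => Nat.zero_le (n i)) (Finset.mem_univ m)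
    set g : ℕ → ℝ := fun k => ((Nat.factorial k : ℝ)⁻¹) *
      ∏ j ∈ Finset.range k, ((B + 1) * Real.sqrt ((s : ℝ) + 1 + j)) with hg
    have hgpos : ∀ k, 0 < g k := fun k => by
      refine mul_pos (by positivity) (Finset.prod_pos fun j _ => by positivity)
    have hgs : Summable g := by
      refine summable_of_ratio_test_tendsto_lt_one (l := 0) one_pos
        (Filter.Eventually.of_forall fun k => (hgpos k).ne') ?_
      have hr : ∀ k : ℕ, ‖g (k + 1)‖ / ‖g k‖ =
          (B + 1) * (Real.sqrt ((s : ℝ) + 1 + k) / ((k : ℝ) + 1)) := by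
        intro k
        rw [Real.norm_of_nonneg (hgpos _).le, Real.norm_of_nonneg (hgpos _).le,
          div_eq_iff (hgpos k).ne']
        simp only [hg, Finset.prod_range_succ, Nat.factorial_succ]
        push_cast
        have : (k.factorial : ℝ) ≠ 0 := by positivity
        field_simp
      simp_rw [hr]
      rw [← mul_zero (B + 1)]
      refine Filter.Tendsto.const_mul _ ?_
      have hlim : Filter.Tendsto (fun k : ℕ => ((s : ℝ) + 1) * (1 / Real.sqrt ((k : ℝ) + 1)))
          Filter.atTop (nhds 0) := by
        rw [← mul_zero ((s : ℝ) + 1)]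
        refine Filter.Tendsto.const_mul _ ?_
        have h1 : Filter.Tendsto (fun k : ℕ => 1 / ((k : ℝ) + 1)) Filter.atTop (nhds 0) :=
          tendsto_one_div_add_atTop_nhds_zero_nat
        have h2 := (Real.continuous_sqrt.tendsto 0).comp h1
        simpa [Function.comp_def] using h2
      refine squeeze_zero (fun k => by positivity) (fun k => ?_) hlim
      have hk : (0 : ℝ) < (k : ℝ) + 1 := by positivity
      have hsq : Real.sqrt ((k : ℝ) + 1) * Real.sqrt ((k : ℝ) + 1) = (k : ℝ) + 1 :=
        Real.mul_self_sqrt hk.le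
      have hsp : 0 < Real.sqrt ((k : ℝ) + 1) := Real.sqrt_pos.2 hk
      have h3 : Real.sqrt ((s : ℝ) + 1 + k) ≤ ((s : ℝ) + 1) * Real.sqrt ((k : ℝ) + 1) := by
        rw [Real.sqrt_le_left (by positivity), mul_pow, Real.sq_sqrt hk.le]
        have : (0 : ℝ) ≤ s := by positivity
        have : (0 : ℝ) ≤ k := by positivity
        nlinarith [mul_nonneg ‹(0 : ℝ) ≤ s› ‹(0 : ℝ) ≤ k›, mul_nonneg (mul_nonneg ‹(0 : ℝ) ≤ s› ‹(0 : ℝ) ≤ s›) ‹(0 : ℝ) ≤ k›]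
      rw [div_le_iff₀ hk]
      calc _ ≤ ((s : ℝ) + 1) * Real.sqrt ((k : ℝ) + 1) := h3
        _ = _ := by
          nth_rewrite 3 [← hsq]
          field_simp
    refine Summable.of_nonneg_of_le (fun k => by positivity) (fun k => ?_) hgs
    refine mul_le_mul_of_nonneg_left
      ((norm_displacementGenerator_pow_le α k s n hle).trans ?_) (by positivity)
    refine Finset.prod_le_prod (fun j _ => by positivity) fun j _ => ?_
    exact mul_le_mul_of_nonneg_right (by linarith) (Real.sqrt_nonneg _)

theorem parityGenerator_single {M : ℕ} (n : Fin M → ℕ) :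
    parityGenerator M (Finsupp.single n 1) =
      (-(Complex.I * (Real.pi : ℂ)) * ((∑ m, n m : ℕ) : ℂ)) • Finsupp.single n (1 : ℂ) := by
  have h : ∀ m : Fin M, creation m (annihilation m (Finsupp.single n 1)) =
      ((n m : ℕ) : ℂ) • Finsupp.single n (1 : ℂ) := by
    intro m
    simp only [creation, annihilation, Finsupp.linearCombination_single, one_smul,
      Finsupp.smul_single, smul_eq_mul, mul_one]
    by_cases h0 : n m = 0
    · simp [h0]
    · have h1 : n m - 1 + 1 = n m := Nat.sub_add_cancel (Nat.one_le_iff_ne_zero.2 h0)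
      have h2 : (((n m - 1 : ℕ) : ℝ) + 1) = (n m : ℝ) := by exact_mod_cast h1
      simp only [Function.update_self, Function.update_idem, h1, h2, Function.update_eq_self]
      rw [← Complex.ofReal_mul, Real.mul_self_sqrt (by positivity)]
      simp
  simp only [parityGenerator, LinearMap.smul_apply, LinearMap.sum_apply, LinearMap.comp_apply, h]
  rw [← Finset.sum_smul, smul_smul]
  push_cast
  rfl

theorem existsUnique_parity (M : ℕ) :
    ∃! T : FockSpace M →L[ℂ] FockSpace M, IsExp (parityGenerator M) T := by
  refine existsUnique_isExp _ (fun u v => ?_) (fun n => ?_)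
  · simp only [parityGenerator, LinearMap.sum_apply, LinearMap.smul_apply, LinearMap.comp_apply,
      map_sum, map_smul, sum_inner, inner_sum, inner_smul_left, inner_smul_right, inner_creation,
      inner_annihilation, map_neg, map_mul, Complex.conj_I, Complex.conj_ofReal]
    ring
  · set c : ℂ := -(Complex.I * (Real.pi : ℂ)) * ((∑ m, n m : ℕ) : ℂ) with hc
    have hk : ∀ k : ℕ, (parityGenerator M ^ k) (Finsupp.single n 1) =
        c ^ k • Finsupp.single n (1 : ℂ) := by
      intro k
      induction k with
      | zero => simp
      | succ k ih =>
        rw [pow_succ', Module.End.mul_apply, ih, map_smul, parityGenerator_single, smul_smul,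
          pow_succ]
    refine (Real.summable_pow_div_factorial ‖c‖).congr fun k => ?_
    rw [hk, map_smul, norm_smul, norm_embed_single, norm_pow, norm_one]
    ring

/-! ## Displacement, parity and displaced parity operators -/

/-- The displacement operator `D(α) = exp(∑_m (α_m a_m† - α_m^* a_m))`. -/
def displacement {M : ℕ} (α : Fin M → ℂ) : FockSpace M →L[ℂ] FockSpace M :=
  (existsUnique_displacement α).choose

/-- The parity operator `Π = exp(-iπ ∑_m a_m† a_m)`. -/
def parity (M : ℕ) : FockSpace M →L[ℂ] FockSpace M :=
  (existsUnique_parity M).choose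

theorem isExp_displacement {M : ℕ} (α : Fin M → ℂ) :
    IsExp (displacementGenerator α) (displacement α) :=
  (existsUnique_displacement α).choose_spec.1

theorem isExp_parity (M : ℕ) : IsExp (parityGenerator M) (parity M) :=
  (existsUnique_parity M).choose_spec.1

/-- The displaced parity operator `Π(α) = D(α) Π D(α)†`. -/
def displacedParity {M : ℕ} (α : Fin M → ℂ) : FockSpace M →L[ℂ] FockSpace M :=
  displacement α ∘L parity M ∘L ContinuousLinearMap.adjoint (displacement α)

/-- The matrix `C(R; Ξ)` with entries `(1/N) tr[R D(ξ_n - ξ_{n'})]`. -/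
def characteristicMatrix {M N : ℕ} (R : FockSpace M →L[ℂ] FockSpace M) (ξ : Fin N → Fin M → ℂ) :
    Matrix (Fin N) (Fin N) ℂ :=
  Matrix.of fun n n' => (1 / (N : ℂ)) * trace (numberBasis M) (R ∘L displacement (ξ n - ξ n'))

end

end BosonicModes

/-!
The displaced parities `Π(α)` are, up to a factor, the symplectic Fourier transform of the
displacements: integrated against a Gaussian `e^{-s²|α|²}` and the character
`χ_ξ(α) = e^{ξ·α^* - ξ^*·α}`, they give a Gaussian average of displacements centred at `ξ`. Both
sides of this operator identity are bounded, so it can be checked on coherent states, whose span is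
dense. Pairing it with `R` and letting `s → 0` yields the Fourier inversion formula
`tr[R D(ξ)] = (2/π)^M ∫ χ_ξ(α) tr[R Π(α)] dα`. Traces and integrals commute because a trace-class
operator factors, through its polar decomposition `R = U|R|`, as a product of two Hilbert–Schmidt
operators.

Since `χ_{ξ - ξ'} = χ_ξ χ_{ξ'}^*`, the matrix `C(R; Ξ)` is therefore the integral, with weight
`(2/π)^M tr[R Π(α)] / N`, of the rank-one operators `v v^†`, `v = (χ_{ξ_n}(α))_n`, `‖v‖² = N`. By
the singular value decomposition and the Cauchy–Schwarz inequality, the trace norm of such an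
integral is at most the integral of `|weight| · ‖v‖²`.
-/

namespace BosonicModes

section BakerCampbellHausdorff

open Finset

variable {𝕜 𝒜 : Type*} [Field 𝕜] [Ring 𝒜] [Algebra 𝕜 𝒜]

theorem succ_smul_sum_antidiagonal {E F G : Type*} [AddCommGroup E] [Module 𝕜 E]
    [AddCommGroup F] [Module 𝕜 F] [AddCommGroup G] [Module 𝕜 G] (L : E →ₗ[𝕜] F →ₗ[𝕜] G)
    (x : ℕ → E) (y : ℕ → F) (n : ℕ) :
    ((n + 1 : ℕ) : 𝕜) • ∑ p ∈ antidiagonal (n + 1), L (x p.1) (y p.2) =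
      ∑ p ∈ antidiagonal n, L (((p.1 + 1 : ℕ) : 𝕜) • x (p.1 + 1)) (y p.2) +
        ∑ p ∈ antidiagonal n, L (x p.1) (((p.2 + 1 : ℕ) : 𝕜) • y (p.2 + 1)) := by
  have weight_split : ((n + 1 : ℕ) : 𝕜) • ∑ p ∈ antidiagonal (n + 1), L (x p.1) (y p.2) =
      ∑ p ∈ antidiagonal (n + 1), L ((p.1 : 𝕜) • x p.1) (y p.2) +
        ∑ p ∈ antidiagonal (n + 1), L (x p.1) ((p.2 : 𝕜) • y p.2) := by
    rw [smul_sum, ← sum_add_distrib]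
    refine sum_congr rfl fun p hp => ?_
    rw [← mem_antidiagonal.1 hp, Nat.cast_add, add_smul, map_smul, map_smul, LinearMap.smul_apply]
  rw [weight_split, Nat.sum_antidiagonal_succ, Nat.sum_antidiagonal_succ']
  simp

variable (𝕜) in
/-- The divided power `Aᵏ / k!`, the coefficient of `tᵏ` in `exp (t A)`. -/
noncomputable def divPow (A : 𝒜) (k : ℕ) : 𝒜 := (k.factorial : 𝕜)⁻¹ • A ^ k

theorem divPow_zero (A : 𝒜) : divPow 𝕜 A 0 = 1 := by simp [divPow]

theorem divPow_one (A : 𝒜) : divPow 𝕜 A 1 = A := by simp [divPow]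

theorem divPow_smul (t : 𝕜) (A : 𝒜) (k : ℕ) : divPow 𝕜 (t • A) k = t ^ k • divPow 𝕜 A k := by
  rw [divPow, divPow, smul_pow, smul_comm]

/-- The coefficient of `tʲ` in the Gaussian `exp (c t² / 2)`. -/
noncomputable def gaussCoeff (c : 𝕜) (j : ℕ) : 𝕜 :=
  if Even j then ((j / 2).factorial : 𝕜)⁻¹ * (c / 2) ^ (j / 2) else 0

theorem gaussCoeff_zero (c : 𝕜) : gaussCoeff c 0 = 1 := by simp [gaussCoeff]

theorem gaussCoeff_one (c : 𝕜) : gaussCoeff c 1 = 0 := by simp [gaussCoeff]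

theorem gaussCoeff_two_mul (c : 𝕜) (l : ℕ) :
    gaussCoeff c (2 * l) = (l.factorial : 𝕜)⁻¹ * (c / 2) ^ l := by
  simp [gaussCoeff]

theorem pow_succ_mul_of_lie {A B : 𝒜} {c : 𝕜} (hAB : ⁅A, B⁆ = c • (1 : 𝒜)) (j : ℕ) :
    A ^ (j + 1) * B = B * A ^ (j + 1) + (((j + 1 : ℕ) : 𝕜) * c) • A ^ j := by
  have swap : A * B = B * A + c • 1 := by rw [← hAB, Ring.lie_def]; abel
  induction j with
  | zero => simp [swap]
  | succ j ih =>
    rw [pow_succ' A (j + 1), mul_assoc, ih, mul_add, ← mul_assoc, swap, add_mul, mul_smul_comm,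
      ← pow_succ', smul_mul_assoc, one_mul, add_assoc, ← add_smul, mul_assoc]
    congr 2
    push_cast
    ring

variable [CharZero 𝕜]

theorem succ_mul_gaussCoeff (c : 𝕜) (j : ℕ) :
    ((j + 2 : ℕ) : 𝕜) * gaussCoeff c (j + 2) = c * gaussCoeff c j := by
  rcases Nat.even_or_odd' j with ⟨l, rfl | rfl⟩
  · have hl : (l.factorial : 𝕜) ≠ 0 := by exact_mod_cast l.factorial_ne_zero
    have hl' : (l : 𝕜) + 1 ≠ 0 := by exact_mod_cast l.succ_ne_zero
    rw [← Nat.mul_succ, gaussCoeff_two_mul, gaussCoeff_two_mul, Nat.factorial_succ]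
    push_cast [pow_succ]
    field_simp
  · simp [gaussCoeff, Nat.even_add_one]

theorem succ_smul_divPow (A : 𝒜) (k : ℕ) :
    ((k + 1 : ℕ) : 𝕜) • divPow 𝕜 A (k + 1) = A * divPow 𝕜 A k := by
  have hk : ((k + 1 : ℕ) : 𝕜) ≠ 0 := by exact_mod_cast k.succ_ne_zero
  rw [divPow, divPow, smul_smul, mul_smul_comm, ← pow_succ', Nat.factorial_succ, Nat.cast_mul,
    mul_inv, mul_inv_cancel_left₀ hk]

theorem divPow_succ_mul_of_lie {A B : 𝒜} {c : 𝕜} (hAB : ⁅A, B⁆ = c • (1 : 𝒜)) (j : ℕ) :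
    divPow 𝕜 A (j + 1) * B = B * divPow 𝕜 A (j + 1) + c • divPow 𝕜 A j := by
  have hj : ((j + 1 : ℕ) : 𝕜) ≠ 0 := by exact_mod_cast j.succ_ne_zero
  rw [divPow, divPow, smul_mul_assoc, pow_succ_mul_of_lie hAB, smul_add, mul_smul_comm,
    smul_smul, smul_smul, Nat.factorial_succ, Nat.cast_mul]
  congr 2
  field_simp

theorem succ_smul_sum_divPow_mul_divPow {A B : 𝒜} {c : 𝕜} (hAB : ⁅A, B⁆ = c • (1 : 𝒜)) (n : ℕ) :
    ((n + 2 : ℕ) : 𝕜) • ∑ p ∈ antidiagonal (n + 2), divPow 𝕜 A p.1 * divPow 𝕜 B p.2 =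
      (A + B) * ∑ p ∈ antidiagonal (n + 1), divPow 𝕜 A p.1 * divPow 𝕜 B p.2 +
        c • ∑ p ∈ antidiagonal n, divPow 𝕜 A p.1 * divPow 𝕜 B p.2 := by
  have leibniz := succ_smul_sum_antidiagonal (LinearMap.mul 𝕜 𝒜) (divPow 𝕜 A) (divPow 𝕜 B) (n + 1)
  simp only [LinearMap.mul_apply_apply, succ_smul_divPow, ← mul_assoc] at leibniz
  have move_B : ∑ p ∈ antidiagonal (n + 1), divPow 𝕜 A p.1 * B * divPow 𝕜 B p.2 =
      B * ∑ p ∈ antidiagonal (n + 1), divPow 𝕜 A p.1 * divPow 𝕜 B p.2 +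
        c • ∑ p ∈ antidiagonal n, divPow 𝕜 A p.1 * divPow 𝕜 B p.2 := by
    simp only [Nat.sum_antidiagonal_succ, divPow_succ_mul_of_lie hAB, add_mul, sum_add_distrib,
      divPow_zero, one_mul, smul_mul_assoc, mul_add, mul_sum, smul_sum, add_assoc]
    simp only [mul_assoc]
  rw [leibniz, move_B]
  simp only [add_mul, mul_sum, mul_assoc, sum_add_distrib, add_assoc]

theorem succ_smul_sum_gaussCoeff_smul_divPow (A : 𝒜) (c : 𝕜) (n : ℕ) :
    ((n + 2 : ℕ) : 𝕜) • ∑ p ∈ antidiagonal (n + 2), gaussCoeff c p.1 • divPow 𝕜 A p.2 =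
      A * ∑ p ∈ antidiagonal (n + 1), gaussCoeff c p.1 • divPow 𝕜 A p.2 +
        c • ∑ p ∈ antidiagonal n, gaussCoeff c p.1 • divPow 𝕜 A p.2 := by
  have leibniz := succ_smul_sum_antidiagonal (LinearMap.lsmul 𝕜 𝒜) (gaussCoeff c) (divPow 𝕜 A)
    (n + 1)
  simp only [LinearMap.lsmul_apply, succ_smul_divPow] at leibniz
  rw [leibniz, Nat.sum_antidiagonal_succ, add_comm]
  simp only [smul_eq_mul, succ_mul_gaussCoeff, zero_add, gaussCoeff_one, mul_zero, zero_smul,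
    mul_sum, mul_smul_comm, smul_sum, mul_smul]

/-- The Baker–Campbell–Hausdorff identity `exp (tA) exp (tB) = exp (ct²/2) exp (t(A+B))`, compared
coefficientwise in `t`: both sides satisfy the same two-term recursion. -/
theorem sum_divPow_mul_divPow {A B : 𝒜} {c : 𝕜} (hAB : ⁅A, B⁆ = c • (1 : 𝒜)) (n : ℕ) :
    ∑ p ∈ antidiagonal n, divPow 𝕜 A p.1 * divPow 𝕜 B p.2 =
      ∑ p ∈ antidiagonal n, gaussCoeff c p.1 • divPow 𝕜 (A + B) p.2 := by
  induction n using Nat.twoStepInduction with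
  | zero => simp [divPow_zero, gaussCoeff_zero]
  | one => simp [Nat.antidiagonal_succ, divPow_zero, divPow_one, gaussCoeff_zero, gaussCoeff_one,
      add_comm]
  | more n ih₀ ih₁ =>
    have hn : ((n + 2 : ℕ) : 𝕜) ≠ 0 := by exact_mod_cast (n + 1).succ_ne_zero
    refine smul_right_injective 𝒜 hn ?_
    simp only [succ_smul_sum_divPow_mul_divPow hAB, succ_smul_sum_gaussCoeff_smul_divPow, ih₀, ih₁]

end BakerCampbellHausdorff

section Series

open Finset Filter Topology

theorem hasSum_sum_antidiagonal_apply {𝕜 E F G : Type*} [NontriviallyNormedField 𝕜]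
    {σ τ : 𝕜 →+* 𝕜} [RingHomIsometric σ] [RingHomIsometric τ]
    [NormedAddCommGroup E] [NormedSpace 𝕜 E] [NormedAddCommGroup F] [NormedSpace 𝕜 F]
    [NormedAddCommGroup G] [NormedSpace 𝕜 G] [CompleteSpace G] (L : E →SL[σ] F →SL[τ] G)
    {f : ℕ → E} {g : ℕ → F} {x : E} {y : F} (hf : HasSum f x) (hg : HasSum g y)
    (hf' : Summable fun k => ‖f k‖) (hg' : Summable fun k => ‖g k‖) :
    HasSum (fun n => ∑ p ∈ antidiagonal n, L (f p.1) (g p.2)) (L x y) := by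
  have summable_prod : Summable fun p : ℕ × ℕ => L (f p.1) (g p.2) :=
    Summable.of_norm_bounded
      ((hf'.mul_of_nonneg hg' (fun _ => norm_nonneg _) fun _ => norm_nonneg _).mul_left ‖L‖)
      fun p => (L.le_opNorm₂ _ _).trans_eq (mul_assoc _ _ _)
  have hasSum_prod : HasSum (fun p : ℕ × ℕ => L (f p.1) (g p.2)) (L x y) := by
    have iterated := summable_prod.hasSum.prod_fiberwise fun i => hg.mapL (L (f i))
    have limit_eq : _ = L x y := iterated.unique (hf.mapL (L.flip y))
    exact limit_eq ▸ summable_prod.hasSum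
  refine ((HasAntidiagonal.sigmaAntidiagonalEquivProd (A := ℕ)).hasSum_iff.2 hasSum_prod).sigma
    fun n => ?_
  rw [← sum_attach (antidiagonal n) fun p => L (f p.1) (g p.2)]
  exact hasSum_fintype _

theorem hasSum_gaussCoeff (c : ℂ) : HasSum (gaussCoeff c) (Complex.exp (c / 2)) := by
  have even_terms : HasSum (fun l => gaussCoeff c (2 * l)) (Complex.exp (c / 2)) := by
    rw [Complex.exp_eq_exp_ℂ]
    simpa [gaussCoeff_two_mul, div_eq_inv_mul] using NormedSpace.expSeries_div_hasSum_exp (c / 2)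
  refine ((mul_right_injective₀ (two_ne_zero' ℕ)).hasSum_iff fun j hj => ?_).1 even_terms
  exact if_neg fun even_j => hj (even_j.two_dvd.imp fun _ h => h.symm)

theorem hasDerivAt_zero_of_hasSum_pow_smul {𝕜 E : Type*} [NontriviallyNormedField 𝕜]
    [NormedAddCommGroup E] [NormedSpace 𝕜 E] {f : 𝕜 → E} {a : ℕ → E}
    (h : ∀ᶠ t in 𝓝 0, HasSum (fun n => t ^ n • a n) (f t)) : HasDerivAt f (a 1) 0 := by
  have expansion : HasFPowerSeriesAt f
      (fun n => ContinuousMultilinearMap.mkPiRing 𝕜 (Fin n) (a n)) 0 := by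
    refine hasFPowerSeriesAt_iff.2 (h.mono fun t ht => ?_)
    simpa [FormalMultilinearSeries.coeff] using ht
  simpa using expansion.hasDerivAt

end Series

section Exponential

open Finset Topology

variable {M : ℕ} {A A' B : FiniteVec M →ₗ[ℂ] FiniteVec M}
  {S S' T U : FockSpace M →L[ℂ] FockSpace M}

theorem FockSpace.ext_embed (h : ∀ v, S (embed M v) = T (embed M v)) : S = T :=
  DFunLike.coe_injective ((denseRange_embed M).equalizer S.continuous T.continuous (funext h))

/-- `A†` extends `B`: the operators `A` and `B` on finite vectors are adjoint to each other with
respect to the inner product of Fock space. -/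
def IsFormalAdjoint (A B : FiniteVec M →ₗ[ℂ] FiniteVec M) : Prop :=
  ∀ u v, ⟪embed M (A u), embed M v⟫_ℂ = ⟪embed M u, embed M (B v)⟫_ℂ

theorem IsFormalAdjoint.pow (h : IsFormalAdjoint A B) (k : ℕ) :
    IsFormalAdjoint (A ^ k) (B ^ k) := by
  induction k with
  | zero => exact fun _ _ => rfl
  | succ k ih =>
    intro u v
    rw [pow_succ, Module.End.mul_apply, ih, h, pow_succ', Module.End.mul_apply]

theorem IsFormalAdjoint.divPow (h : IsFormalAdjoint A B) (k : ℕ) :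
    IsFormalAdjoint (divPow ℂ A k) (divPow ℂ B k) := by
  intro u v
  simp only [BosonicModes.divPow, LinearMap.smul_apply, map_smul, inner_smul_left,
    inner_smul_right, h.pow k u v, map_inv₀, Complex.conj_natCast]

theorem IsExp.hasSum_divPow (h : IsExp A T) (v : FiniteVec M) :
    HasSum (fun k => embed M (divPow ℂ A k v)) (T (embed M v)) := by
  simpa [divPow] using h v

theorem isExp_zero :
    IsExp (0 : FiniteVec M →ₗ[ℂ] FiniteVec M) (1 : FockSpace M →L[ℂ] FockSpace M) := by
  intro v
  have head := hasSum_single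
    (f := fun k => (k.factorial : ℂ)⁻¹ • embed M ((0 ^ k : Module.End ℂ (FiniteVec M)) v)) 0
    fun k hk => by simp [hk]
  simpa using head

theorem IsExp.inner_apply_left (hS : IsExp A S) (hT : IsExp B T) (hAB : IsFormalAdjoint A B)
    (x y : FockSpace M) : ⟪S x, y⟫_ℂ = ⟪x, T y⟫_ℂ := by
  refine (denseRange_embed M).induction_on₂ (p := fun x y => ⟪S x, y⟫_ℂ = ⟪x, T y⟫_ℂ)
    (isClosed_eq (by fun_prop) (by fun_prop)) (fun u v => ?_) x y
  have left := ((hS.hasSum_divPow u).mapL ((innerSL ℂ).flip (embed M v)))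
  have right := (hT.hasSum_divPow v).mapL (innerSL ℂ (embed M u))
  simp only [ContinuousLinearMap.flip_apply, innerSL_apply_apply, hAB.divPow _ u v] at left right
  exact left.unique right

theorem IsExp.comp_eq_comp_of_semiconj {P : FiniteVec M →ₗ[ℂ] FiniteVec M} (hS : IsExp A S)
    (hT : IsExp B T) (hU : ∀ v, U (embed M v) = embed M (P v)) (hP : SemiconjBy P A B) :
    U ∘L S = T ∘L U := by
  refine FockSpace.ext_embed fun v => ?_
  have apply_P : ∀ k, P (divPow ℂ A k v) = divPow ℂ B k (P v) := fun k => by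
    simp only [divPow, LinearMap.smul_apply, map_smul]
    exact congrArg _ (LinearMap.congr_fun (hP.pow_right k).eq v)
  have image := (hS.hasSum_divPow v).mapL U
  simp only [hU, apply_P] at image
  rw [ContinuousLinearMap.comp_apply, ContinuousLinearMap.comp_apply, hU]
  exact image.unique (hT.hasSum_divPow (P v))

theorem hasDerivAt_apply_embed_of_isExp {S : ℝ → FockSpace M →L[ℂ] FockSpace M}
    (hS : ∀ t : ℝ, IsExp ((t : ℂ) • A) (S t)) (v : FiniteVec M) :
    HasDerivAt (fun t => S t (embed M v)) (embed M (A v)) 0 := by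
  have expansion := hasDerivAt_zero_of_hasSum_pow_smul (a := fun n => embed M (divPow ℂ A n v))
    (Filter.Eventually.of_forall fun t => ((hS t).hasSum_divPow v).congr_fun fun n => by
      rw [divPow_smul, LinearMap.smul_apply, map_smul, ← Complex.ofReal_pow, Complex.coe_smul]
      rfl)
  simpa [divPow_one] using expansion

/-- `T = exp A` and the exponential series of `A` converges absolutely on finite vectors, which is
what Cauchy products of exponential series need. -/
structure IsAbsExp (A : FiniteVec M →ₗ[ℂ] FiniteVec M) (T : FockSpace M →L[ℂ] FockSpace M) :
    Prop where
  isExp : IsExp A T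
  summable_norm (v : FiniteVec M) : Summable fun k => ‖embed M (divPow ℂ A k v)‖

theorem IsExp.isAbsExp (hS : IsExp A S) (hT : IsExp ((2 : ℂ) • A) T) : IsAbsExp A S := by
  refine ⟨hS, fun v => ?_⟩
  obtain ⟨C, hC⟩ := (hT.hasSum_divPow v).summable.tendsto_atTop_zero.norm.bddAbove_range
  refine Summable.of_nonneg_of_le (fun _ => norm_nonneg _) (fun k => ?_)
    (summable_geometric_two.mul_left C)
  have term_le := hC ⟨k, rfl⟩
  simp only [divPow_smul, LinearMap.smul_apply, map_smul, norm_smul, norm_pow,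
    Complex.norm_ofNat] at term_le
  rwa [one_div, inv_pow, ← div_eq_mul_inv, le_div_iff₀ (by positivity), mul_comm]

theorem IsAbsExp.hasSum_gaussCoeff_smul_divPow (h : IsAbsExp A T) (c : ℂ) (v : FiniteVec M) :
    HasSum (fun n => embed M ((∑ p ∈ antidiagonal n, gaussCoeff c p.1 • divPow ℂ A p.2) v))
      (Complex.exp (c / 2) • T (embed M v)) := by
  have product := hasSum_sum_antidiagonal_apply (ContinuousLinearMap.lsmul ℂ ℂ)
    (hasSum_gaussCoeff c) (h.isExp.hasSum_divPow v)
    (hasSum_gaussCoeff c).summable.norm (h.summable_norm v)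
  simpa [LinearMap.sum_apply, map_sum] using product

theorem IsAbsExp.comp_of_lie {c : ℂ} (hS : IsAbsExp A S) (hS' : IsAbsExp A' S')
    (hA : IsFormalAdjoint A' A) (hT : IsAbsExp B T) (hU : IsAbsExp (A + B) U)
    (hAB : ⁅A, B⁆ = c • (1 : Module.End ℂ (FiniteVec M))) :
    S ∘L T = Complex.exp (c / 2) • U := by
  refine FockSpace.ext_embed fun v => (denseRange_embed M).eq_of_inner_right ℂ fun u => ?_
  have left := hasSum_sum_antidiagonal_apply (innerSL ℂ) (hS'.isExp.hasSum_divPow u)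
    (hT.isExp.hasSum_divPow v) (hS'.summable_norm u) (hT.summable_norm v)
  have right := (hU.hasSum_gaussCoeff_smul_divPow c v).mapL (innerSL ℂ (embed M u))
  simp only [innerSL_apply_apply, hA.divPow _ _ _, ← Module.End.mul_apply, ← inner_sum, ← map_sum,
    ← LinearMap.sum_apply, sum_divPow_mul_divPow hAB] at left
  rw [ContinuousLinearMap.comp_apply, ← hS'.isExp.inner_apply_left hS.isExp hA]
  exact left.unique right

theorem IsAbsExp.inner_vacuum {c : ℂ} {X X' Y : FiniteVec M →ₗ[ℂ] FiniteVec M} {v : FiniteVec M}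
    (hT : IsAbsExp (X + Y) T) (hXY : ⁅X, Y⁆ = c • (1 : Module.End ℂ (FiniteVec M)))
    (hX : IsFormalAdjoint X' X) (hX' : X' v = 0) (hY : Y v = 0) :
    Complex.exp (c / 2) * ⟪embed M v, T (embed M v)⟫_ℂ = ⟪embed M v, embed M v⟫_ℂ := by
  have divPow_vanish : ∀ {Z : Module.End ℂ (FiniteVec M)}, Z v = 0 →
      ∀ k, divPow ℂ Z (k + 1) v = 0 :=
    fun hZ k => by simp [divPow, pow_succ, hZ]
  have higher_vanish : ∀ n ≠ 0, ⟪embed M v,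
      embed M ((∑ p ∈ antidiagonal n, gaussCoeff c p.1 • divPow ℂ (X + Y) p.2) v)⟫_ℂ = 0 := by
    rintro (_ | n) hn
    · exact absurd rfl hn
    · rw [← sum_divPow_mul_divPow hXY, Nat.sum_antidiagonal_succ']
      simp [divPow_vanish hY, divPow_zero, ← hX.divPow (n + 1) v v, divPow_vanish hX']
  have series := (hT.hasSum_gaussCoeff_smul_divPow c v).mapL (innerSL ℂ (embed M v))
  rw [innerSL_apply_apply, inner_smul_right] at series
  refine series.unique ?_
  simpa [gaussCoeff_zero, divPow_zero] using hasSum_single 0 higher_vanish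

end Exponential

section Displacement

theorem lie_sum_smul_sum_smul {R 𝒜 ι κ : Type*} [CommRing R] [Ring 𝒜] [Algebra R 𝒜]
    [Fintype ι] [Fintype κ] (x : ι → R) (y : κ → R) (A : ι → 𝒜) (B : κ → 𝒜) :
    ⁅∑ i, x i • A i, ∑ j, y j • B j⁆ = ∑ i, ∑ j, (x i * y j) • ⁅A i, B j⁆ := by
  have right_product : (∑ j, y j • B j) * ∑ i, x i • A i =
      ∑ i, ∑ j, (x i * y j) • (B j * A i) := by
    rw [Finset.sum_mul_sum, Finset.sum_comm]
    simp only [smul_mul_smul_comm, mul_comm]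
  rw [Ring.lie_def, right_product, Finset.sum_mul_sum]
  simp only [smul_mul_smul_comm, Ring.lie_def, smul_sub, Finset.sum_sub_distrib]

theorem lie_neg_eq_lie_swap {𝒜 : Type*} [Ring 𝒜] (X Y : 𝒜) : ⁅X, -Y⁆ = ⁅Y, X⁆ := by
  simp only [Ring.lie_def]
  noncomm_ring

theorem lie_sub_sub_of_lie_eq_zero {𝒜 : Type*} [Ring 𝒜] {X X' Y Y' : 𝒜} (hX : ⁅X, X'⁆ = 0)
    (hY : ⁅Y, Y'⁆ = 0) : ⁅X - Y, X' - Y'⁆ = ⁅Y', X⁆ - ⁅Y, X'⁆ := by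
  have split : ⁅X - Y, X' - Y'⁆ = ⁅X, X'⁆ + ⁅Y, Y'⁆ + ⁅Y', X⁆ - ⁅Y, X'⁆ := by
    simp only [Ring.lie_def]
    noncomm_ring
  rw [split, hX, hY, add_zero, zero_add]

variable {M : ℕ}

/-- The operator on finite vectors that acts on mode `m` alone, by `|k⟩ ↦ w k |f k⟩`: the common
form of the creation and annihilation operators. -/
noncomputable def modeShift (m : Fin M) (f : ℕ → ℕ) (w : ℕ → ℂ) : Module.End ℂ (FiniteVec M) :=
  Finsupp.linearCombination ℂ fun n => Finsupp.single (Function.update n m (f (n m))) (w (n m))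

theorem modeShift_single (m : Fin M) (f : ℕ → ℕ) (w : ℕ → ℂ) (n : Fin M → ℕ) (c : ℂ) :
    modeShift m f w (Finsupp.single n c) =
      Finsupp.single (Function.update n m (f (n m))) (c * w (n m)) := by
  simp [modeShift]

theorem creation_eq_modeShift (m : Fin M) :
    creation m = modeShift m (· + 1) fun k => (Real.sqrt ((k : ℝ) + 1) : ℂ) := rfl

theorem annihilation_eq_modeShift (m : Fin M) :
    annihilation m = modeShift m (· - 1) fun k => (Real.sqrt (k : ℝ) : ℂ) := rfl

theorem commute_modeShift {m m' : Fin M} (h : m ≠ m') (f g : ℕ → ℕ) (w z : ℕ → ℂ) :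
    Commute (modeShift m f w) (modeShift m' g z) := by
  refine Finsupp.lhom_ext fun n c => ?_
  simp only [Module.End.mul_apply, modeShift_single, Function.update_comm h,
    Function.update_of_ne h, Function.update_of_ne h.symm]
  rw [mul_right_comm]

theorem lie_creation_creation (m m' : Fin M) :
    ⁅(creation m : Module.End ℂ (FiniteVec M)), creation m'⁆ = 0 := by
  rcases eq_or_ne m m' with rfl | h
  · exact sub_self _
  · rw [creation_eq_modeShift, creation_eq_modeShift]
    exact sub_eq_zero_of_eq (commute_modeShift h _ _ _ _).eq

theorem lie_annihilation_annihilation (m m' : Fin M) :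
    ⁅(annihilation m : Module.End ℂ (FiniteVec M)), annihilation m'⁆ = 0 := by
  rcases eq_or_ne m m' with rfl | h
  · exact sub_self _
  · rw [annihilation_eq_modeShift, annihilation_eq_modeShift]
    exact sub_eq_zero_of_eq (commute_modeShift h _ _ _ _).eq

theorem creation_annihilation_single (m : Fin M) (n : Fin M → ℕ) (c : ℂ) :
    creation m (annihilation m (Finsupp.single n c)) = Finsupp.single n (c * n m) := by
  rw [annihilation_eq_modeShift, creation_eq_modeShift, modeShift_single, modeShift_single,
    Function.update_self, Function.update_idem]
  rcases Nat.eq_zero_or_eq_succ_pred (n m) with h | h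
  · simp [h]
  · have sqrt_eq : Real.sqrt (((n m - 1 : ℕ) : ℝ) + 1) = Real.sqrt (n m) := by
      rw [h]
      simp
    rw [Nat.sub_add_cancel (by omega), Function.update_eq_self, sqrt_eq, mul_assoc,
      ← Complex.ofReal_mul, Real.mul_self_sqrt (Nat.cast_nonneg _), Complex.ofReal_natCast]

theorem annihilation_creation_single (m : Fin M) (n : Fin M → ℕ) (c : ℂ) :
    annihilation m (creation m (Finsupp.single n c)) = Finsupp.single n (c * (n m + 1)) := by
  rw [annihilation_eq_modeShift, creation_eq_modeShift, modeShift_single, modeShift_single,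
    Function.update_self, Function.update_idem, Nat.add_sub_cancel, Function.update_eq_self,
    Nat.cast_succ, mul_assoc, ← Complex.ofReal_mul, Real.mul_self_sqrt (by positivity)]
  push_cast
  rfl

theorem lie_annihilation_creation (m m' : Fin M) :
    ⁅(annihilation m : Module.End ℂ (FiniteVec M)), creation m'⁆ = if m = m' then 1 else 0 := by
  rcases eq_or_ne m m' with rfl | h
  · rw [if_pos rfl, Ring.lie_def, sub_eq_iff_eq_add]
    refine Finsupp.lhom_ext fun n c => ?_
    simp only [Module.End.mul_apply, LinearMap.add_apply, Module.End.one_apply,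
      annihilation_creation_single, creation_annihilation_single, ← Finsupp.single_add]
    congr 1
    ring
  · rw [if_neg h, annihilation_eq_modeShift, creation_eq_modeShift]
    exact sub_eq_zero_of_eq (commute_modeShift h _ _ _ _).eq

/-- The creation operator `a†(α) = ∑ₘ αₘ aₘ†` of the mode with amplitudes `α`. Together with
`smearedAnnihilation` it splits the generator of `D(α)` into two parts with scalar commutator. -/
noncomputable def smearedCreation (α : Fin M → ℂ) : Module.End ℂ (FiniteVec M) :=
  ∑ m, α m • creation m

/-- The annihilation operator `a(α) = ∑ₘ αₘ^* aₘ`, taken antilinear in `α` so that it is the adjoint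
of `smearedCreation α`. -/
noncomputable def smearedAnnihilation (α : Fin M → ℂ) : Module.End ℂ (FiniteVec M) :=
  ∑ m, conj (α m) • annihilation m

theorem displacementGenerator_eq_sub (α : Fin M → ℂ) :
    displacementGenerator α = smearedCreation α - smearedAnnihilation α := by
  rw [displacementGenerator, smearedCreation, smearedAnnihilation]
  exact Finset.sum_sub_distrib (fun m => α m • creation m) fun m => conj (α m) • annihilation m

theorem lie_smearedAnnihilation_smearedCreation (α β : Fin M → ℂ) :
    ⁅smearedAnnihilation α, smearedCreation β⁆ =
      (β ⬝ᵥ star α) • (1 : Module.End ℂ (FiniteVec M)) := by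
  refine (lie_sum_smul_sum_smul (fun m => conj (α m)) β annihilation creation).trans ?_
  simp [lie_annihilation_creation, dotProduct, Finset.sum_smul, mul_comm]

/-- The symplectic form `α ⬝ β^* - β ⬝ α^*` of phase space `ℂᴹ`, which governs the commutation of
displacements. It takes values in `iℝ`, as it is not divided by `2 i`. -/
def symplecticForm (α β : Fin M → ℂ) : ℂ := α ⬝ᵥ star β - β ⬝ᵥ star α

theorem lie_displacementGenerator (α β : Fin M → ℂ) :
    ⁅displacementGenerator α, displacementGenerator β⁆ =
      symplecticForm α β • (1 : Module.End ℂ (FiniteVec M)) := by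
  have creation_part : ⁅smearedCreation α, smearedCreation β⁆ = 0 :=
    (lie_sum_smul_sum_smul α β creation creation).trans
      (by simp [lie_creation_creation])
  have annihilation_part : ⁅smearedAnnihilation α, smearedAnnihilation β⁆ = 0 :=
    (lie_sum_smul_sum_smul (fun m => conj (α m)) (fun m => conj (β m)) annihilation
      annihilation).trans (by simp [lie_annihilation_annihilation])
  rw [displacementGenerator_eq_sub, displacementGenerator_eq_sub]
  refine (lie_sub_sub_of_lie_eq_zero creation_part annihilation_part).trans ?_
  rw [lie_smearedAnnihilation_smearedCreation, lie_smearedAnnihilation_smearedCreation]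
  exact (sub_smul (α ⬝ᵥ star β) (β ⬝ᵥ star α) (1 : Module.End ℂ (FiniteVec M))).symm

theorem displacementGenerator_add (α β : Fin M → ℂ) :
    displacementGenerator (α + β) = displacementGenerator α + displacementGenerator β := by
  simp only [displacementGenerator, ← Finset.sum_add_distrib, Pi.add_apply, map_add]
  exact Finset.sum_congr rfl fun m _ => by module

theorem displacementGenerator_real_smul (t : ℝ) (α : Fin M → ℂ) :
    displacementGenerator (t • α) = (t : ℂ) • displacementGenerator α := by
  simp only [displacementGenerator, Finset.smul_sum, Pi.smul_apply, Complex.real_smul, map_mul,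
    Complex.conj_ofReal]
  exact Finset.sum_congr rfl fun m _ => by module

theorem displacementGenerator_zero : displacementGenerator (0 : Fin M → ℂ) = 0 := by
  simpa using displacementGenerator_real_smul 0 (0 : Fin M → ℂ)

theorem isFormalAdjoint_displacementGenerator (α : Fin M → ℂ) :
    IsFormalAdjoint (displacementGenerator α) (displacementGenerator (-α)) := by
  intro u v
  simp only [displacementGenerator, LinearMap.sum_apply, LinearMap.sub_apply,
    LinearMap.smul_apply, map_sum, map_sub, map_smul, sum_inner, inner_sum, inner_sub_left,
    inner_sub_right, inner_smul_left, inner_smul_right, inner_creation, inner_annihilation,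
    Complex.conj_conj, Pi.neg_apply, map_neg]
  exact Finset.sum_congr rfl fun m _ => by ring

theorem isFormalAdjoint_smearedAnnihilation (α : Fin M → ℂ) :
    IsFormalAdjoint (smearedAnnihilation α) (smearedCreation α) := by
  intro u v
  simp only [smearedAnnihilation, smearedCreation, LinearMap.sum_apply, LinearMap.smul_apply,
    map_sum, map_smul, sum_inner, inner_sum, inner_smul_left, inner_smul_right,
    inner_annihilation, Complex.conj_conj]

theorem isAbsExp_displacement (α : Fin M → ℂ) :
    IsAbsExp (displacementGenerator α) (displacement α) := by
  refine (isExp_displacement α).isAbsExp (T := displacement ((2 : ℝ) • α)) ?_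
  have doubled := isExp_displacement ((2 : ℝ) • α)
  rwa [displacementGenerator_real_smul, Complex.ofReal_ofNat] at doubled

theorem inner_displacement_left (α : Fin M → ℂ) (x y : FockSpace M) :
    ⟪displacement α x, y⟫_ℂ = ⟪x, displacement (-α) y⟫_ℂ :=
  (isExp_displacement α).inner_apply_left (isExp_displacement (-α))
    (isFormalAdjoint_displacementGenerator α) x y

theorem adjoint_displacement (α : Fin M → ℂ) :
    ContinuousLinearMap.adjoint (displacement α) = displacement (-α) :=
  ((ContinuousLinearMap.eq_adjoint_iff _ _).2 fun x y => by
    rw [inner_displacement_left, neg_neg]).symm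

theorem displacement_displacement (α β : Fin M → ℂ) (x : FockSpace M) :
    displacement α (displacement β x) =
      Complex.exp (symplecticForm α β / 2) • displacement (α + β) x := by
  have adj := isFormalAdjoint_displacementGenerator (-α)
  rw [neg_neg] at adj
  have sum_exp := isAbsExp_displacement (α + β)
  rw [displacementGenerator_add] at sum_exp
  exact DFunLike.congr_fun ((isAbsExp_displacement α).comp_of_lie (isAbsExp_displacement (-α)) adj
    (isAbsExp_displacement β) sum_exp (lie_displacementGenerator α β)) x

theorem displacement_zero : displacement (0 : Fin M → ℂ) = 1 :=
  (existsUnique_displacement 0).unique (isExp_displacement 0)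
    (displacementGenerator_zero (M := M) ▸ isExp_zero)

theorem symplecticForm_neg_self (α : Fin M → ℂ) : symplecticForm (-α) α = 0 := by
  simp [symplecticForm]

theorem norm_displacement_apply (α : Fin M → ℂ) (x : FockSpace M) :
    ‖displacement α x‖ = ‖x‖ := by
  have inner_eq : ⟪displacement α x, displacement α x⟫_ℂ = ⟪x, x⟫_ℂ := by
    rw [inner_displacement_left, displacement_displacement, symplecticForm_neg_self,
      neg_add_cancel, displacement_zero]
    simp
  rw [@norm_eq_sqrt_re_inner ℂ, inner_eq, ← @norm_eq_sqrt_re_inner ℂ]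

theorem hasDerivAt_displacement_smul (α : Fin M → ℂ) (v : FiniteVec M) :
    HasDerivAt (fun t : ℝ => displacement (t • α) (embed M v))
      (embed M (displacementGenerator α v)) 0 :=
  hasDerivAt_apply_embed_of_isExp
    (fun t => displacementGenerator_real_smul t α ▸ isExp_displacement (t • α)) v

end Displacement

section CoherentStates

variable {M : ℕ}

theorem smearedAnnihilation_vacuum (α : Fin M → ℂ) :
    smearedAnnihilation α (Finsupp.single 0 1) = 0 := by
  simp [smearedAnnihilation, annihilation, LinearMap.sum_apply]

theorem inner_vacuum_displacement (α : Fin M → ℂ) :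
    ⟪numberBasis M 0, displacement α (numberBasis M 0)⟫_ℂ = Complex.exp (-(α ⬝ᵥ star α) / 2) := by
  have abs_exp : IsAbsExp (smearedCreation α + -smearedAnnihilation α) (displacement α) := by
    rw [← sub_eq_add_neg (smearedCreation α), ← displacementGenerator_eq_sub]
    exact isAbsExp_displacement α
  have commutator : ⁅smearedCreation α, -smearedAnnihilation α⁆ =
      (α ⬝ᵥ star α) • (1 : Module.End ℂ (FiniteVec M)) :=
    (lie_neg_eq_lie_swap _ _).trans (lie_smearedAnnihilation_smearedCreation α α)
  have vacuum := abs_exp.inner_vacuum commutator (isFormalAdjoint_smearedAnnihilation α)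
    (smearedAnnihilation_vacuum α) (by simp [smearedAnnihilation_vacuum])
  rw [embed_single, one_smul,
    inner_self_eq_one_of_norm_eq_one ((numberBasis M).orthonormal.1 0)] at vacuum
  rw [neg_div, Complex.exp_neg]
  exact eq_inv_of_mul_eq_one_right vacuum

/-- The coherent state `|α⟩ = D(α)|0⟩`. Bounded operators are determined by their matrix elements
between coherent states. -/
noncomputable def coherentState (α : Fin M → ℂ) : FockSpace M :=
  displacement α (numberBasis M 0)

theorem inner_coherentState_displacement (β η γ : Fin M → ℂ) :
    ⟪coherentState β, displacement η (coherentState γ)⟫_ℂ =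
      Complex.exp (-(η ⬝ᵥ star η) / 2 + η ⬝ᵥ star β - γ ⬝ᵥ star η + γ ⬝ᵥ star β -
        β ⬝ᵥ star β / 2 - γ ⬝ᵥ star γ / 2) := by
  rw [coherentState, coherentState, inner_displacement_left, displacement_displacement,
    inner_smul_right, displacement_displacement, inner_smul_right, inner_vacuum_displacement,
    ← Complex.exp_add, ← Complex.exp_add]
  congr 1
  simp only [symplecticForm, star_add, star_neg, add_dotProduct, dotProduct_add, neg_dotProduct,
    dotProduct_neg]
  ring

theorem creation_eq_displacementGenerator (m : Fin M) (v : FiniteVec M) :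
    creation m v = (2⁻¹ : ℂ) • displacementGenerator (Pi.single m 1) v -
      (2⁻¹ * Complex.I) • displacementGenerator (Pi.single m Complex.I) v := by
  have single_mode : ∀ z : ℂ, displacementGenerator (Pi.single m z) v =
      z • creation m v - conj z • annihilation m v := by
    intro z
    rw [displacementGenerator_eq_sub, LinearMap.sub_apply]
    simp [smearedCreation, smearedAnnihilation, Pi.single_apply, apply_ite conj]
  rw [single_mode, single_mode, map_one, Complex.conj_I]
  match_scalars
  · linear_combination (2⁻¹ : ℂ) * Complex.I_mul_I
  · linear_combination (2⁻¹ : ℂ) * Complex.I_mul_I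

variable {K : Submodule ℂ (FockSpace M)}

theorem embed_displacementGenerator_mem (hK : IsClosed (K : Set (FockSpace M)))
    (hD : ∀ α, ∀ x ∈ K, displacement α x ∈ K) {v : FiniteVec M} (hv : embed M v ∈ K)
    (α : Fin M → ℂ) : embed M (displacementGenerator α v) ∈ K := by
  have orbit_deriv := hasDerivAt_displacement_smul α v
  rw [← orbit_deriv.deriv]
  have mem_closure := range_deriv_subset_closure_span_image
    (fun t : ℝ => displacement (t • α) (embed M v)) dense_univ ⟨0, rfl⟩
  have span_le : Submodule.span ℝ ((fun t : ℝ => displacement (t • α) (embed M v)) '' Set.univ) ≤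
      K.restrictScalars ℝ :=
    Submodule.span_le.2 (by rintro _ ⟨t, -, rfl⟩; exact hD _ _ hv)
  exact closure_minimal (show _ ⊆ (K : Set (FockSpace M)) from span_le) hK mem_closure

theorem embed_creation_mem (hK : IsClosed (K : Set (FockSpace M)))
    (hD : ∀ α, ∀ x ∈ K, displacement α x ∈ K) {v : FiniteVec M} (hv : embed M v ∈ K)
    (m : Fin M) : embed M (creation m v) ∈ K := by
  rw [creation_eq_displacementGenerator, map_sub, map_smul, map_smul]
  exact K.sub_mem (K.smul_mem _ (embed_displacementGenerator_mem hK hD hv _))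
    (K.smul_mem _ (embed_displacementGenerator_mem hK hD hv _))

theorem numberBasis_mem_of_vacuum_mem (hK : IsClosed (K : Set (FockSpace M)))
    (hD : ∀ α, ∀ x ∈ K, displacement α x ∈ K) (h0 : numberBasis M 0 ∈ K) (n : Fin M → ℕ) :
    numberBasis M n ∈ K := by
  induction hs : ∑ m, n m generalizing n with
  | zero =>
    obtain rfl : n = 0 := funext fun m => Finset.sum_eq_zero_iff.1 hs m (Finset.mem_univ m)
    exact h0
  | succ s ih =>
    obtain ⟨m, hm⟩ : ∃ m, n m ≠ 0 := by
      by_contra! all_zero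
      simp [all_zero] at hs
    set n' := Function.update n m (n m - 1) with hn'
    have lower_mem : embed M (Finsupp.single n' 1) ∈ K := by
      rw [embed_single, one_smul]
      refine ih _ ?_
      rw [Finset.sum_update_of_mem (Finset.mem_univ m), Finset.sdiff_singleton_eq_erase]
      rw [← Finset.add_sum_erase _ _ (Finset.mem_univ m)] at hs
      omega
    have raised := embed_creation_mem hK hD lower_mem m
    rw [creation_eq_modeShift, modeShift_single, hn', Function.update_self, Function.update_idem,
      Nat.sub_add_cancel (Nat.one_le_iff_ne_zero.2 hm), Function.update_eq_self, embed_single,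
      one_mul] at raised
    refine (K.smul_mem_iff ?_).1 raised
    exact Complex.ofReal_ne_zero.2 (by positivity)

/-- The span of the coherent states, a dense subspace invariant under displacements. -/
noncomputable def coherentSpan (M : ℕ) : Submodule ℂ (FockSpace M) :=
  Submodule.span ℂ (Set.range coherentState)

theorem displacement_mem_coherentSpan (α : Fin M → ℂ) {x : FockSpace M}
    (hx : x ∈ coherentSpan M) : displacement α x ∈ coherentSpan M := by
  have coherent_image : coherentSpan M ≤ (coherentSpan M).comap (displacement α).toLinearMap := by
    refine Submodule.span_le.2 ?_
    rintro _ ⟨γ, rfl⟩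
    simp only [SetLike.mem_coe, Submodule.mem_comap, ContinuousLinearMap.coe_coe, coherentState,
      displacement_displacement]
    exact Submodule.smul_mem _ _ (Submodule.subset_span ⟨α + γ, rfl⟩)
  exact coherent_image hx

theorem dense_coherentSpan (M : ℕ) : Dense (coherentSpan M : Set (FockSpace M)) := by
  have vacuum_mem : numberBasis M 0 ∈ (coherentSpan M).topologicalClosure :=
    Submodule.le_topologicalClosure _
      (Submodule.subset_span ⟨0, by simp [coherentState, displacement_zero]⟩)
  rw [Submodule.dense_iff_topologicalClosure_eq_top, eq_top_iff, ← (numberBasis M).dense_span]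
  refine Submodule.topologicalClosure_minimal _ (Submodule.span_le.2 ?_)
    (Submodule.isClosed_topologicalClosure _)
  rintro _ ⟨n, rfl⟩
  refine numberBasis_mem_of_vacuum_mem (Submodule.isClosed_topologicalClosure _)
    (fun α x hx => ?_) vacuum_mem n
  exact map_mem_closure (displacement α).continuous hx fun _ => displacement_mem_coherentSpan α

theorem ext_inner_coherentState {S T : FockSpace M →L[ℂ] FockSpace M}
    (h : ∀ β γ, ⟪coherentState β, S (coherentState γ)⟫_ℂ =
      ⟪coherentState β, T (coherentState γ)⟫_ℂ) : S = T := by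
  refine ContinuousLinearMap.ext_on (dense_coherentSpan M) ?_
  rintro _ ⟨γ, rfl⟩
  have functional_eq : innerSL ℂ (S (coherentState γ)) = innerSL ℂ (T (coherentState γ)) := by
    refine ContinuousLinearMap.ext_on (dense_coherentSpan M) ?_
    rintro _ ⟨β, rfl⟩
    rw [innerSL_apply_apply, innerSL_apply_apply, ← inner_conj_symm, h, inner_conj_symm]
  exact ext_inner_right ℂ fun x => DFunLike.congr_fun functional_eq x

end CoherentStates

section Parity

variable {M : ℕ}

theorem parityGenerator_pow_single (n : Fin M → ℕ) (k : ℕ) :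
    (parityGenerator M ^ k) (Finsupp.single n 1) =
      (-(Complex.I * (Real.pi : ℂ)) * ((∑ m, n m : ℕ) : ℂ)) ^ k • Finsupp.single n (1 : ℂ) := by
  induction k with
  | zero => simp
  | succ k ih =>
    rw [pow_succ', Module.End.mul_apply, ih, map_smul, parityGenerator_single, smul_smul, pow_succ]

theorem parity_numberBasis (n : Fin M → ℕ) :
    parity M (numberBasis M n) = ((-1 : ℂ) ^ ∑ m, n m) • numberBasis M n := by
  set z := -(Complex.I * (Real.pi : ℂ)) * ((∑ m, n m : ℕ) : ℂ) with hz
  have exp_z : Complex.exp z = (-1 : ℂ) ^ ∑ m, n m := by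
    rw [hz, mul_comm, Complex.exp_nat_mul, Complex.exp_neg, mul_comm, Complex.exp_pi_mul_I]
    norm_num
  have exp_series : HasSum (fun k : ℕ => (k.factorial : ℂ)⁻¹ * z ^ k) (Complex.exp z) := by
    rw [Complex.exp_eq_exp_ℂ]
    simpa [div_eq_inv_mul] using NormedSpace.expSeries_div_hasSum_exp z
  have parity_series := isExp_parity M (Finsupp.single n 1)
  simp only [parityGenerator_pow_single, map_smul, smul_smul, embed_single, one_smul]
    at parity_series
  exact exp_z ▸ parity_series.unique (exp_series.smul_const _)

/-- The parity operator `|n⟩ ↦ (-1)^(n₁ + ⋯ + n_M) |n⟩` on finite vectors, where its commutation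
with the creation and annihilation operators is an algebraic statement. -/
noncomputable def finiteParity (M : ℕ) : Module.End ℂ (FiniteVec M) :=
  Finsupp.linearCombination ℂ fun n => Finsupp.single n ((-1 : ℂ) ^ ∑ m, n m)

theorem finiteParity_single (n : Fin M → ℕ) (c : ℂ) :
    finiteParity M (Finsupp.single n c) = Finsupp.single n (c * (-1 : ℂ) ^ ∑ m, n m) := by
  simp [finiteParity]

theorem parity_embed (v : FiniteVec M) : parity M (embed M v) = embed M (finiteParity M v) := by
  induction v using Finsupp.induction_linear with
  | zero => simp
  | add u v hu hv => simp only [map_add, hu, hv]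
  | single n c =>
    rw [embed_single, map_smul, parity_numberBasis, finiteParity_single, embed_single, smul_smul]

theorem finiteParity_modeShift {f : ℕ → ℕ} {w : ℕ → ℂ}
    (hf : ∀ k, w k ≠ 0 → (-1 : ℂ) ^ f k = -(-1) ^ k) (m : Fin M) (v : FiniteVec M) :
    finiteParity M (modeShift m f w v) = -modeShift m f w (finiteParity M v) := by
  induction v using Finsupp.induction_linear with
  | zero => simp
  | add u v hu hv => simp only [map_add, hu, hv, neg_add]
  | single n c =>
    rw [modeShift_single, finiteParity_single, finiteParity_single, modeShift_single,
      ← Finsupp.single_neg]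
    congr 1
    by_cases hw : w (n m) = 0
    · simp [hw]
    · rw [Finset.sum_update_of_mem (Finset.mem_univ m), ← Finset.add_sum_erase _ n
        (Finset.mem_univ m), Finset.sdiff_singleton_eq_erase, pow_add, pow_add, hf _ hw]
      ring

theorem finiteParity_creation (m : Fin M) (v : FiniteVec M) :
    finiteParity M (creation m v) = -creation m (finiteParity M v) := by
  rw [creation_eq_modeShift]
  exact finiteParity_modeShift (fun k _ => by ring) m v

theorem finiteParity_annihilation (m : Fin M) (v : FiniteVec M) :
    finiteParity M (annihilation m v) = -annihilation m (finiteParity M v) := by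
  rw [annihilation_eq_modeShift]
  refine finiteParity_modeShift (fun k hk => ?_) m v
  obtain ⟨j, rfl⟩ := Nat.exists_eq_succ_of_ne_zero (n := k) (by rintro rfl; simp at hk)
  simp [pow_succ]

theorem semiconjBy_finiteParity_displacementGenerator (α : Fin M → ℂ) :
    SemiconjBy (finiteParity M) (displacementGenerator α) (displacementGenerator (-α)) := by
  refine LinearMap.ext fun v => ?_
  simp only [Module.End.mul_apply, displacementGenerator, LinearMap.sum_apply,
    LinearMap.sub_apply, LinearMap.smul_apply, map_sum, map_sub, map_smul, finiteParity_creation,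
    finiteParity_annihilation, Pi.neg_apply, map_neg]
  exact Finset.sum_congr rfl fun m _ => by module

theorem parity_displacement (α : Fin M → ℂ) (x : FockSpace M) :
    parity M (displacement α x) = displacement (-α) (parity M x) :=
  DFunLike.congr_fun ((isExp_displacement α).comp_eq_comp_of_semiconj (isExp_displacement (-α))
    parity_embed (semiconjBy_finiteParity_displacementGenerator α)) x

theorem displacedParity_apply (α : Fin M → ℂ) (x : FockSpace M) :
    displacedParity α x = displacement ((2 : ℝ) • α) (parity M x) := by
  rw [displacedParity, ContinuousLinearMap.comp_apply, ContinuousLinearMap.comp_apply,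
    adjoint_displacement, parity_displacement, neg_neg, displacement_displacement, two_smul]
  simp [symplecticForm]

theorem parity_coherentState (α : Fin M → ℂ) :
    parity M (coherentState α) = coherentState (-α) := by
  rw [coherentState, parity_displacement, parity_numberBasis]
  simp [coherentState]

end Parity

section Gaussian

open MeasureTheory
open scoped ComplexOrder

variable {M : ℕ}

theorem integral_cexp_neg_mul_conj_add {b : ℂ} (hb : 0 < b.re) (c d : ℂ) :
    ∫ z : ℂ, Complex.exp (-b * (z * conj z) + z * c + d * conj z) =
      Real.pi / b * Complex.exp (c * d / b) := by
  have hb0 : b ≠ 0 := by rintro rfl; simp at hb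
  have real_coordinates : ∀ v : Fin 2 → ℝ,
      -b * (Complex.measurableEquivPi.symm v * conj (Complex.measurableEquivPi.symm v)) +
          Complex.measurableEquivPi.symm v * c + d * conj (Complex.measurableEquivPi.symm v) =
        -b * ∑ i, (v i : ℂ) ^ 2 + ∑ i, ![c + d, Complex.I * (c - d)] i * v i := by
    intro v
    simp only [Complex.measurableEquivPi_symm_apply, Fin.sum_univ_two, map_add, map_mul,
      Complex.conj_ofReal, Complex.conj_I, Matrix.cons_val_zero, Matrix.cons_val_one]
    linear_combination b * (v 1 : ℂ) ^ 2 * Complex.I_sq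
  rw [← Complex.volume_preserving_equiv_pi.symm.integral_comp
    Complex.measurableEquivPi.symm.measurableEmbedding]
  simp_rw [real_coordinates]
  rw [GaussianFourier.integral_cexp_neg_mul_sum_add hb, Fintype.card_fin, Fin.sum_univ_two]
  congr 1
  · norm_num
  · congr 1
    simp only [Matrix.cons_val_zero, Matrix.cons_val_one]
    field_simp
    linear_combination (c - d) ^ 2 * Complex.I_sq

theorem integral_cexp_neg_mul_dotProduct_add {b : ℂ} (hb : 0 < b.re) (β γ : Fin M → ℂ) :
    ∫ α : Fin M → ℂ, Complex.exp (-b * (α ⬝ᵥ star α) + α ⬝ᵥ star β + γ ⬝ᵥ star α) =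
      (Real.pi / b) ^ M * Complex.exp (γ ⬝ᵥ star β / b) := by
  have factor : ∀ α : Fin M → ℂ,
      Complex.exp (-b * (α ⬝ᵥ star α) + α ⬝ᵥ star β + γ ⬝ᵥ star α) =
        ∏ m, Complex.exp (-b * (α m * conj (α m)) + α m * conj (β m) + γ m * conj (α m)) := by
    intro α
    simp only [dotProduct, Finset.mul_sum, ← Finset.sum_add_distrib, Complex.exp_sum]
    rfl
  simp_rw [factor]
  rw [integral_fintype_prod_volume_eq_prod
    fun m (z : ℂ) => Complex.exp (-b * (z * conj z) + z * conj (β m) + γ m * conj z)]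
  simp_rw [integral_cexp_neg_mul_conj_add hb]
  rw [Finset.prod_mul_distrib, Finset.prod_const, Finset.card_univ, Fintype.card_fin,
    ← Complex.exp_sum, ← Finset.sum_div, dotProduct]
  simp only [Pi.star_apply, starRingEnd_apply, mul_comm]

/-- The Gaussian weight `exp(-b |α|²)` on `ℂᴹ`, complex-valued because it multiplies traces. -/
noncomputable def gaussian (b : ℝ) (α : Fin M → ℂ) : ℂ := Complex.exp (-b * (α ⬝ᵥ star α))

theorem continuous_gaussian (b : ℝ) : Continuous (gaussian (M := M) b) := by
  unfold gaussian
  fun_prop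

theorem norm_gaussian_le_one {b : ℝ} (hb : 0 ≤ b) (α : Fin M → ℂ) : ‖gaussian b α‖ ≤ 1 := by
  rw [gaussian, Complex.norm_exp, Real.exp_le_one_iff, ← Complex.ofReal_neg, Complex.re_ofReal_mul]
  exact mul_nonpos_of_nonpos_of_nonneg (neg_nonpos.2 hb)
    (Complex.nonneg_iff.1 (dotProduct_self_star_nonneg α)).1

theorem integral_gaussian {b : ℝ} (hb : 0 < b) :
    ∫ α : Fin M → ℂ, gaussian b α = (Real.pi / b : ℂ) ^ M := by
  simpa [gaussian] using integral_cexp_neg_mul_dotProduct_add (M := M) (b := b) (by simpa) 0 0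

theorem integrable_gaussian {b : ℝ} (hb : 0 < b) : Integrable (gaussian (M := M) b) := by
  refine Integrable.of_integral_ne_zero ?_
  rw [integral_gaussian hb]
  have : (Real.pi : ℂ) / b ≠ 0 :=
    div_ne_zero (Complex.ofReal_ne_zero.2 Real.pi_ne_zero) (Complex.ofReal_ne_zero.2 hb.ne')
  exact pow_ne_zero M this

/-- The character `α ↦ exp(ξ·α^* - α·ξ^*)` of `ℂᴹ`, the kernel of the symplectic Fourier
transform. -/
noncomputable def symplecticCharacter (ξ α : Fin M → ℂ) : ℂ := Complex.exp (symplecticForm ξ α)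

theorem continuous_symplecticCharacter (ξ : Fin M → ℂ) : Continuous (symplecticCharacter ξ) := by
  unfold symplecticCharacter symplecticForm
  fun_prop

theorem conj_symplecticForm (ξ α : Fin M → ℂ) :
    conj (symplecticForm ξ α) = -symplecticForm ξ α := by
  rw [symplecticForm, map_sub, neg_sub, starRingEnd_apply, starRingEnd_apply,
    ← Matrix.dotProduct_star, ← Matrix.dotProduct_star]

theorem norm_symplecticCharacter (ξ α : Fin M → ℂ) : ‖symplecticCharacter ξ α‖ = 1 := by
  rw [symplecticCharacter, Complex.norm_exp, Real.exp_eq_one_iff]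
  have re_conj := congrArg Complex.re (conj_symplecticForm ξ α)
  rw [Complex.conj_re, Complex.neg_re] at re_conj
  linarith

theorem symplecticCharacter_sub (ξ ξ' α : Fin M → ℂ) :
    symplecticCharacter (ξ - ξ') α =
      symplecticCharacter ξ α * conj (symplecticCharacter ξ' α) := by
  rw [symplecticCharacter, symplecticCharacter, symplecticCharacter, ← Complex.exp_conj,
    conj_symplecticForm, ← Complex.exp_add]
  congr 1
  simp only [symplecticForm, star_sub, sub_dotProduct, dotProduct_sub]
  ring

end Gaussian

section OperatorFamily

open MeasureTheory Topology

variable {X Y H : Type*} [TopologicalSpace X] [TopologicalSpace Y] [NormedAddCommGroup H]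
  [InnerProductSpace ℂ H]

theorem continuous_of_continuous_inner {f : X → H} (norm_continuous : Continuous fun x => ‖f x‖)
    (inner_continuous : ∀ x₀, Continuous fun x => ⟪f x, f x₀⟫_ℂ) : Continuous f := by
  refine continuous_iff_continuousAt.2 fun x₀ => tendsto_iff_norm_sub_tendsto_zero.2 ?_
  have dist_formula : ∀ x, ‖f x - f x₀‖ =
      √(‖f x‖ ^ 2 - 2 * (⟪f x, f x₀⟫_ℂ).re + ‖f x₀‖ ^ 2) := fun x => by
    rw [← Real.sqrt_sq (norm_nonneg (f x - f x₀)), norm_sub_sq (𝕜 := ℂ), RCLike.re_eq_complex_re]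
  have dist_continuous : Continuous fun x => ‖f x - f x₀‖ := by
    simp only [dist_formula]
    have := inner_continuous x₀
    fun_prop
  simpa using dist_continuous.tendsto x₀

theorem continuous_apply_of_dense_span {𝕜 E F : Type*} [NontriviallyNormedField 𝕜]
    [NormedAddCommGroup E] [NormedSpace 𝕜 E] [NormedAddCommGroup F] [NormedSpace 𝕜 F]
    {T : X → E →L[𝕜] F} {C : NNReal} (hC : ∀ a, ‖T a‖ ≤ C) {s : Set E}
    (hs : Dense (Submodule.span 𝕜 s : Set E)) (h : ∀ y ∈ s, Continuous fun a => T a y) (y : E) :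
    Continuous fun a => T a y := by
  have continuous_on_span : ∀ z ∈ Submodule.span 𝕜 s, Continuous fun a => T a z := by
    intro z hz
    induction hz using Submodule.span_induction with
    | mem z hz => exact h z hz
    | zero => simpa only [map_zero] using continuous_const
    | add z z' _ _ hz hz' => exact (funext fun a => map_add (T a) z z') ▸ hz.add hz'
    | smul c z _ hz => exact (funext fun a => map_smul (T a) c z) ▸ hz.const_smul c
  have equicontinuous : Equicontinuous fun a => (T a : E → F) :=
    (LipschitzWith.uniformEquicontinuous _ C fun a =>
      (T a).lipschitzWith_of_opNorm_le (hC a)).equicontinuous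
  refine continuous_iff_continuousAt.2 fun a₀ => ?_
  exact closure_minimal (fun z hz => (continuous_on_span z hz).tendsto a₀)
    (equicontinuous.isClosed_setOfPred_tendsto (T a₀).continuous) (hs y)

/-- A uniformly bounded, strongly continuous family of operators: the setting in which
`∫ k(a) T(a) da` makes sense for every integrable weight `k`, even though `a ↦ T(a)` need not be
measurable in operator norm. -/
structure IsBoundedFamily (T : X → H →L[ℂ] H) : Prop where
  exists_norm_le : ∃ C : ℝ, ∀ a, ‖T a‖ ≤ C
  continuous_apply : ∀ y, Continuous fun a => T a y

namespace IsBoundedFamily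

variable {T : X → H →L[ℂ] H}

theorem comp (hT : IsBoundedFamily T) {f : Y → X} (hf : Continuous f) :
    IsBoundedFamily fun a => T (f a) :=
  ⟨hT.exists_norm_le.imp fun _ hC a => hC (f a), fun y => (hT.continuous_apply y).comp hf⟩

theorem comp_const (hT : IsBoundedFamily T) (S : H →L[ℂ] H) :
    IsBoundedFamily fun a => T a ∘L S := by
  obtain ⟨C, hC⟩ := hT.exists_norm_le
  refine ⟨⟨C * ‖S‖, fun a => ?_⟩, fun y => hT.continuous_apply (S y)⟩
  exact ((T a).opNorm_comp_le S).trans (by gcongr; exact hC a)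

variable [MeasurableSpace X] [OpensMeasurableSpace X] [SecondCountableTopology X] {μ : Measure X}
  {k : X → ℂ}

theorem integrable_smul_apply (hT : IsBoundedFamily T) (hk : Integrable k μ) (y : H) :
    Integrable (fun a => k a • T a y) μ := by
  obtain ⟨C, hC⟩ := hT.exists_norm_le
  exact hk.smul_bdd (C * ‖y‖) (hT.continuous_apply y).aestronglyMeasurable
    (.of_forall fun a => (T a).le_of_opNorm_le (hC a) y)

/-- The operator `∫ k(a) T(a) da`, with the integral taken in the strong sense. -/
noncomputable def strongIntegral (hT : IsBoundedFamily T) (hk : Integrable k μ) : H →L[ℂ] H :=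
  LinearMap.mkContinuousOfExistsBound
    { toFun := fun y => ∫ a, k a • T a y ∂μ
      map_add' := fun y z => by
        simp only [map_add, smul_add]
        exact integral_add (hT.integrable_smul_apply hk y) (hT.integrable_smul_apply hk z)
      map_smul' := fun c y => by
        simp only [map_smul, smul_comm _ c, integral_smul, RingHom.id_apply] }
    (by
      obtain ⟨C, hC⟩ := hT.exists_norm_le
      refine ⟨(∫ a, ‖k a‖ ∂μ) * C, fun y => ?_⟩
      rw [mul_assoc, ← integral_mul_const]
      refine norm_integral_le_of_norm_le (hk.norm.mul_const _) (.of_forall fun a => ?_)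
      rw [norm_smul]
      gcongr
      exact (T a).le_of_opNorm_le (hC a) y)

theorem inner_strongIntegral_apply [CompleteSpace H] (hT : IsBoundedFamily T)
    (hk : Integrable k μ) (x y : H) :
    ⟪x, hT.strongIntegral hk y⟫_ℂ = ∫ a, k a * ⟪x, T a y⟫_ℂ ∂μ := by
  simp only [← inner_smul_right]
  exact (integral_inner (hT.integrable_smul_apply hk y) x).symm

end IsBoundedFamily

end OperatorFamily

section GaussianMean

open MeasureTheory

variable {M : ℕ}

theorem inner_coherentState (β γ : Fin M → ℂ) :
    ⟪coherentState β, coherentState γ⟫_ℂ =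
      Complex.exp (γ ⬝ᵥ star β - β ⬝ᵥ star β / 2 - γ ⬝ᵥ star γ / 2) := by
  simpa [displacement_zero] using inner_coherentState_displacement β 0 γ

theorem norm_coherentState (β : Fin M → ℂ) : ‖coherentState β‖ = 1 := by
  rw [coherentState, norm_displacement_apply, (numberBasis M).orthonormal.1]

theorem continuous_coherentState : Continuous (coherentState (M := M)) := by
  refine continuous_of_continuous_inner ?_ fun γ => ?_
  · simpa only [norm_coherentState] using continuous_const
  · simp only [inner_coherentState]
    fun_prop

theorem continuous_displacement_coherentState (γ : Fin M → ℂ) :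
    Continuous fun α => displacement α (coherentState γ) := by
  have phase_continuous : Continuous fun α : Fin M → ℂ =>
      Complex.exp (symplecticForm α γ / 2) := by
    unfold symplecticForm
    fun_prop
  simp only [coherentState, displacement_displacement]
  exact phase_continuous.smul (continuous_coherentState.comp (continuous_add_const γ))

theorem isBoundedFamily_displacement (M : ℕ) :
    IsBoundedFamily fun α : Fin M → ℂ => displacement α := by
  have norm_le_one : ∀ α : Fin M → ℂ, ‖displacement α‖ ≤ (1 : NNReal) := fun α =>
    ContinuousLinearMap.opNorm_le_bound _ zero_le_one fun x => by
      simp [norm_displacement_apply]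
  refine ⟨⟨_, norm_le_one⟩, continuous_apply_of_dense_span norm_le_one (dense_coherentSpan M) ?_⟩
  rintro _ ⟨γ, rfl⟩
  exact continuous_displacement_coherentState γ

theorem isBoundedFamily_displacedParity (M : ℕ) :
    IsBoundedFamily fun α : Fin M → ℂ => displacedParity α := by
  have displacedParity_eq : ∀ α : Fin M → ℂ,
      displacedParity α = displacement ((2 : ℝ) • α) ∘L parity M :=
    fun α => ContinuousLinearMap.ext (displacedParity_apply α)
  simp only [displacedParity_eq]
  exact ((isBoundedFamily_displacement M).comp (continuous_const_smul (2 : ℝ))).comp_const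
    (parity M)

theorem isBoundedFamily_displacement_add_smul (ξ : Fin M → ℂ) (s : ℝ) :
    IsBoundedFamily fun η : Fin M → ℂ => displacement (ξ + s • η) :=
  (isBoundedFamily_displacement M).comp (by fun_prop)

theorem integrable_gaussian_mul_symplecticCharacter {b : ℝ} (hb : 0 < b) (ξ : Fin M → ℂ) :
    Integrable fun α => gaussian b α * symplecticCharacter ξ α :=
  (integrable_gaussian hb).mul_bdd (c := 1) (continuous_symplecticCharacter ξ).aestronglyMeasurable
    (.of_forall fun α => (norm_symplecticCharacter ξ α).le)

theorem integral_gaussian_mul_inner_displacedParity (s : ℝ) (ξ β γ : Fin M → ℂ) :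
    ∫ α, gaussian (s ^ 2) α * symplecticCharacter ξ α *
        ⟪coherentState β, displacedParity α (coherentState γ)⟫_ℂ =
      (Real.pi / (2 + s ^ 2 : ℂ)) ^ M *
        Complex.exp ((2 • γ + ξ) ⬝ᵥ star (2 • β - ξ) / (2 + s ^ 2)) *
        Complex.exp (-(γ ⬝ᵥ star β) - β ⬝ᵥ star β / 2 - γ ⬝ᵥ star γ / 2) := by
  have integrand : ∀ α : Fin M → ℂ, gaussian (s ^ 2) α * symplecticCharacter ξ α *
        ⟪coherentState β, displacedParity α (coherentState γ)⟫_ℂ =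
      Complex.exp (-(2 + s ^ 2 : ℂ) * (α ⬝ᵥ star α) + α ⬝ᵥ star (2 • β - ξ) +
        (2 • γ + ξ) ⬝ᵥ star α) *
        Complex.exp (-(γ ⬝ᵥ star β) - β ⬝ᵥ star β / 2 - γ ⬝ᵥ star γ / 2) := by
    intro α
    rw [displacedParity_apply, parity_coherentState, inner_coherentState_displacement, gaussian,
      symplecticCharacter, ← Complex.exp_add, ← Complex.exp_add, ← Complex.exp_add, symplecticForm]
    congr 1
    simp only [two_smul, star_add, star_sub, star_neg, add_dotProduct, dotProduct_add,
      dotProduct_sub, neg_dotProduct, dotProduct_neg]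
    push_cast
    ring
  simp_rw [integrand]
  have re_pos : 0 < (2 + s ^ 2 : ℂ).re := by
    rw [← Complex.ofReal_pow, Complex.add_re, Complex.ofReal_re, Complex.re_ofNat]
    positivity
  rw [integral_mul_const, integral_cexp_neg_mul_dotProduct_add re_pos]

theorem integral_gaussian_mul_inner_displacement (s : ℝ) (ξ β γ : Fin M → ℂ) :
    ∫ η, gaussian 1 η *
        ⟪coherentState β, displacement (ξ + s • η) (coherentState γ)⟫_ℂ =
      (Real.pi / (1 + s ^ 2 / 2 : ℂ)) ^ M *
        Complex.exp ((-s • (γ + (2⁻¹ : ℝ) • ξ)) ⬝ᵥ star (s • (β - (2⁻¹ : ℝ) • ξ)) /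
          (1 + s ^ 2 / 2)) *
        Complex.exp (-(ξ ⬝ᵥ star ξ) / 2 + ξ ⬝ᵥ star β - γ ⬝ᵥ star ξ + γ ⬝ᵥ star β -
          β ⬝ᵥ star β / 2 - γ ⬝ᵥ star γ / 2) := by
  have integrand : ∀ η : Fin M → ℂ, gaussian 1 η *
        ⟪coherentState β, displacement (ξ + s • η) (coherentState γ)⟫_ℂ =
      Complex.exp (-(1 + s ^ 2 / 2 : ℂ) * (η ⬝ᵥ star η) +
        η ⬝ᵥ star (s • (β - (2⁻¹ : ℝ) • ξ)) + (-s • (γ + (2⁻¹ : ℝ) • ξ)) ⬝ᵥ star η) *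
        Complex.exp (-(ξ ⬝ᵥ star ξ) / 2 + ξ ⬝ᵥ star β - γ ⬝ᵥ star ξ + γ ⬝ᵥ star β -
          β ⬝ᵥ star β / 2 - γ ⬝ᵥ star γ / 2) := by
    intro η
    rw [inner_coherentState_displacement, gaussian, ← Complex.exp_add, ← Complex.exp_add]
    congr 1
    simp only [star_add, star_sub, star_smul, star_trivial, add_dotProduct, dotProduct_add,
      dotProduct_sub, smul_dotProduct, dotProduct_smul, Complex.real_smul]
    push_cast
    ring
  simp_rw [integrand]
  have re_pos : 0 < (1 + s ^ 2 / 2 : ℂ).re := by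
    rw [← Complex.ofReal_pow, ← Complex.ofReal_ofNat, ← Complex.ofReal_div, Complex.add_re,
      Complex.ofReal_re, Complex.one_re]
    positivity
  rw [integral_mul_const, integral_cexp_neg_mul_dotProduct_add re_pos]

theorem strongIntegral_gaussian_displacedParity {s : ℝ} (hs : 0 < s ^ 2) (ξ : Fin M → ℂ) :
    (2 / Real.pi : ℂ) ^ M • (isBoundedFamily_displacedParity M).strongIntegral
        (integrable_gaussian_mul_symplecticCharacter hs ξ) =
      (1 / Real.pi : ℂ) ^ M • (isBoundedFamily_displacement_add_smul ξ s).strongIntegral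
        (integrable_gaussian one_pos) := by
  refine ext_inner_coherentState fun β γ => ?_
  simp only [smul_apply, inner_smul_right,
    IsBoundedFamily.inner_strongIntegral_apply, integral_gaussian_mul_inner_displacedParity,
    integral_gaussian_mul_inner_displacement]
  have pi_ne : (Real.pi : ℂ) ≠ 0 := Complex.ofReal_ne_zero.2 Real.pi_ne_zero
  have denom_ne : (2 + s ^ 2 : ℂ) ≠ 0 := by exact_mod_cast (by positivity : 2 + s ^ 2 ≠ 0)
  have denom_eq : (1 + s ^ 2 / 2 : ℂ) = (2 + s ^ 2) / 2 := by ring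
  rw [denom_eq, mul_assoc, mul_assoc, ← Complex.exp_add, ← Complex.exp_add, ← mul_assoc,
    ← mul_assoc, ← mul_pow, ← mul_pow]
  congr 2
  · field_simp
  · simp only [two_smul, star_add, star_sub, star_smul, star_trivial, add_dotProduct,
      dotProduct_add, dotProduct_sub, smul_dotProduct, dotProduct_smul, Complex.real_smul]
    push_cast
    field_simp
    ring

end GaussianMean

section TraceClassOperators

open MeasureTheory

variable {ι H : Type*} [NormedAddCommGroup H] [InnerProductSpace ℂ H]

theorem trace_smul (b : HilbertBasis ι ℂ H) (c : ℂ) (T : H →L[ℂ] H) :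
    trace b (c • T) = c * trace b T := by
  simp only [trace, smul_apply, inner_smul_right, tsum_mul_left]

theorem norm_inner_apply_le (T : H →L[ℂ] H) (x y : H) : ‖⟪x, T y⟫_ℂ‖ ≤ ‖T‖ * (‖x‖ * ‖y‖) :=
  calc ‖⟪x, T y⟫_ℂ‖ ≤ ‖x‖ * ‖T y‖ := norm_inner_le_norm _ _
    _ ≤ ‖x‖ * (‖T‖ * ‖y‖) := by gcongr; exact T.le_opNorm y
    _ = ‖T‖ * (‖x‖ * ‖y‖) := mul_left_comm _ _ _

theorem hasSum_norm_inner_sq (b : HilbertBasis ι ℂ H) (x : H) :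
    HasSum (fun i => ‖⟪b i, x⟫_ℂ‖ ^ 2) (‖x‖ ^ 2) := by
  have parseval := b.hasSum_inner_mul_inner x x
  have term_eq : ∀ i, ⟪x, b i⟫_ℂ * ⟪b i, x⟫_ℂ = ((‖⟪b i, x⟫_ℂ‖ ^ 2 : ℝ) : ℂ) := fun i => by
    rw [← inner_conj_symm, Complex.conj_mul', Complex.ofReal_pow]
  simp only [term_eq, inner_self_eq_norm_sq_to_K] at parseval
  exact Complex.hasSum_ofReal.1 (by simpa using parseval)

/-- `A` is Hilbert–Schmidt: `∑ᵢ ‖A bᵢ‖² < ∞`, for one (equivalently, every) orthonormal basis. -/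
def IsHilbertSchmidt (b : HilbertBasis ι ℂ H) (A : H →L[ℂ] H) : Prop :=
  Summable fun i => ‖A (b i)‖ ^ 2

namespace IsHilbertSchmidt

variable {b : HilbertBasis ι ℂ H} {A B : H →L[ℂ] H}

theorem comp_left (hA : IsHilbertSchmidt b A) (T : H →L[ℂ] H) : IsHilbertSchmidt b (T ∘L A) := by
  refine Summable.of_nonneg_of_le (fun _ => by positivity) (fun i => ?_)
    (hA.mul_left (‖T‖ ^ 2))
  rw [← mul_pow]
  gcongr
  exact T.le_opNorm _

theorem summable_norm_mul_norm (hA : IsHilbertSchmidt b A) (hB : IsHilbertSchmidt b B) :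
    Summable fun i => ‖A (b i)‖ * ‖B (b i)‖ :=
  Summable.of_nonneg_of_le (fun _ => by positivity)
    (fun i => by
      nlinarith [two_mul_le_add_sq ‖A (b i)‖ ‖B (b i)‖, sq_nonneg ‖A (b i)‖,
        sq_nonneg ‖B (b i)‖])
    (hA.add hB)

theorem summable_norm_inner_sq (hA : IsHilbertSchmidt b A) :
    Summable fun p : ι × ι => ‖⟪b p.2, A (b p.1)⟫_ℂ‖ ^ 2 := by
  rw [summable_prod_of_nonneg fun p => by positivity]
  refine ⟨fun j => (hasSum_norm_inner_sq b (A (b j))).summable, ?_⟩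
  simp only [(hasSum_norm_inner_sq b (A (b _))).tsum_eq]
  exact hA

end IsHilbertSchmidt

variable [CompleteSpace H]

theorem exists_comp_eq_of_norm_apply_le {E F : Type*} [NormedAddCommGroup E] [NormedSpace ℂ E]
    [NormedAddCommGroup F] [NormedSpace ℂ F] [CompleteSpace F] {A : E →L[ℂ] F} {B : E →L[ℂ] H}
    {C : ℝ} (h : ∀ x, ‖A x‖ ≤ C * ‖B x‖) : ∃ U : H →L[ℂ] F, U ∘L B = A := by
  set K := B.range.topologicalClosure
  set B' : E →ₗ[ℂ] K :=
    B.toLinearMap.codRestrict K fun x => B.range.le_topologicalClosure ⟨x, rfl⟩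
  have dense_range : DenseRange B' := by
    refine Subtype.dense_iff.2 fun y hy => closure_mono ?_ hy
    rintro _ ⟨x, rfl⟩
    exact ⟨B' x, ⟨x, rfl⟩, rfl⟩
  refine ⟨A.toLinearMap.extendOfNorm B' ∘L K.orthogonalProjectionOnto,
    ContinuousLinearMap.ext fun x => ?_⟩
  have projection_eq : K.orthogonalProjectionOnto (B x) = B' x :=
    K.orthogonalProjectionOnto_mem_subspace_eq_self (B' x)
  rw [ContinuousLinearMap.comp_apply, ContinuousLinearMap.comp_apply, projection_eq]
  exact LinearMap.extendOfNorm_eq dense_range ⟨C, h⟩ x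

theorem absOp_comp_absOp (T : H →L[ℂ] H) :
    absOp T ∘L absOp T = ContinuousLinearMap.adjoint T ∘L T :=
  CFC.abs_mul_abs T

theorem adjoint_absOp (T : H →L[ℂ] H) : ContinuousLinearMap.adjoint (absOp T) = absOp T :=
  (IsSelfAdjoint.of_nonneg (CFC.abs_nonneg T)).adjoint_eq

theorem norm_absOp_apply (T : H →L[ℂ] H) (x : H) : ‖absOp T x‖ = ‖T x‖ := by
  rw [← sq_eq_sq₀ (norm_nonneg _) (norm_nonneg _),
    ContinuousLinearMap.apply_norm_sq_eq_inner_adjoint_left,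
    ContinuousLinearMap.apply_norm_sq_eq_inner_adjoint_left, adjoint_absOp, absOp_comp_absOp]

theorem exists_comp_absOp_eq (T : H →L[ℂ] H) : ∃ U : H →L[ℂ] H, U ∘L absOp T = T :=
  exists_comp_eq_of_norm_apply_le (C := 1) fun x => by rw [norm_absOp_apply, one_mul]

namespace IsHilbertSchmidt

variable {b : HilbertBasis ι ℂ H} {A B : H →L[ℂ] H}

theorem hasSum_inner_adjoint (hA : IsHilbertSchmidt b A) (hB : IsHilbertSchmidt b B) :
    HasSum (fun i => ⟪ContinuousLinearMap.adjoint A (b i), ContinuousLinearMap.adjoint B (b i)⟫_ℂ)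
      (∑' j, ⟪B (b j), A (b j)⟫_ℂ) := by
  set F : ι × ι → ℂ := fun p => ⟪B (b p.1), b p.2⟫_ℂ * ⟪b p.2, A (b p.1)⟫_ℂ with hF
  have summable_F : Summable F := by
    refine Summable.of_norm_bounded (hA.summable_norm_inner_sq.add hB.summable_norm_inner_sq)
      fun p => ?_
    rw [hF, norm_mul, norm_inner_symm]
    nlinarith [two_mul_le_add_sq ‖⟪b p.2, A (b p.1)⟫_ℂ‖ ‖⟪b p.2, B (b p.1)⟫_ℂ‖,
      sq_nonneg ‖⟪b p.2, A (b p.1)⟫_ℂ‖, sq_nonneg ‖⟪b p.2, B (b p.1)⟫_ℂ‖]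
  have sum_rows : ∀ j, HasSum (fun i => F (j, i)) ⟪B (b j), A (b j)⟫_ℂ := fun j =>
    b.hasSum_inner_mul_inner (B (b j)) (A (b j))
  have sum_columns : ∀ i, HasSum (fun j => F (j, i))
      ⟪ContinuousLinearMap.adjoint A (b i), ContinuousLinearMap.adjoint B (b i)⟫_ℂ := fun i => by
    refine (b.hasSum_inner_mul_inner _ _).congr_fun fun j => ?_
    rw [ContinuousLinearMap.adjoint_inner_left, ContinuousLinearMap.adjoint_inner_right, mul_comm]
  rw [(summable_F.hasSum.prod_fiberwise sum_rows).tsum_eq]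
  exact ((Equiv.prodComm ι ι).hasSum_iff.2 summable_F.hasSum).prod_fiberwise sum_columns

end IsHilbertSchmidt

namespace IsTraceClass

variable {b : HilbertBasis ι ℂ H} {R : H →L[ℂ] H}

theorem exists_eq_comp_adjoint (hR : IsTraceClass b R) :
    ∃ A B : H →L[ℂ] H, IsHilbertSchmidt b A ∧ IsHilbertSchmidt b B ∧
      R = A ∘L ContinuousLinearMap.adjoint B := by
  obtain ⟨U, hU⟩ := exists_comp_absOp_eq R
  set S := CFC.sqrt (absOp R)
  have S_sq : S ∘L S = absOp R := CFC.sqrt_mul_sqrt_self _ (CFC.abs_nonneg R)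
  have adjoint_S : ContinuousLinearMap.adjoint S = S :=
    (IsSelfAdjoint.of_nonneg (CFC.sqrt_nonneg _)).adjoint_eq
  have hS : IsHilbertSchmidt b S := hR.congr fun i => by
    rw [ContinuousLinearMap.apply_norm_sq_eq_inner_adjoint_right, adjoint_S, S_sq]
    rfl
  refine ⟨U ∘L S, S, hS.comp_left U, hS, ?_⟩
  rw [adjoint_S, ContinuousLinearMap.comp_assoc, S_sq, hU]

/-- With `R = A B†`, cyclicity of the trace gives `tr (R T) = ∑ᵢ ⟨B bᵢ, T A bᵢ⟩`. -/
theorem exists_hasSum_trace_comp (hR : IsTraceClass b R) :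
    ∃ x y : ι → H, (Summable fun i => ‖x i‖ * ‖y i‖) ∧
      ∀ T : H →L[ℂ] H, HasSum (fun i => ⟪x i, T (y i)⟫_ℂ) (trace b (R ∘L T)) := by
  obtain ⟨A, B, hA, hB, rfl⟩ := hR.exists_eq_comp_adjoint
  refine ⟨fun i => B (b i), fun i => A (b i), hB.summable_norm_mul_norm hA, fun T => ?_⟩
  have summable_inner : Summable fun i => ⟪B (b i), T (A (b i))⟫_ℂ :=
    .of_norm_bounded ((hB.summable_norm_mul_norm hA).mul_left ‖T‖) fun i =>
      norm_inner_apply_le T (B (b i)) (A (b i))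
  have cyclic := (hA.hasSum_inner_adjoint (hB.comp_left (ContinuousLinearMap.adjoint T))).tsum_eq
  simp only [ContinuousLinearMap.adjoint_comp, ContinuousLinearMap.adjoint_adjoint,
    ContinuousLinearMap.comp_apply, ContinuousLinearMap.adjoint_inner_left] at cyclic
  rw [trace]
  simp only [ContinuousLinearMap.comp_apply, cyclic]
  exact summable_inner.hasSum

end IsTraceClass

namespace IsBoundedFamily

variable {X : Type*} [TopologicalSpace X] {b : HilbertBasis ι ℂ H} {R : H →L[ℂ] H}
  {T : X → H →L[ℂ] H}

theorem exists_norm_trace_comp_le (hT : IsBoundedFamily T) (hR : IsTraceClass b R) :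
    ∃ K : ℝ, ∀ a, ‖trace b (R ∘L T a)‖ ≤ K := by
  obtain ⟨C, hC⟩ := hT.exists_norm_le
  obtain ⟨x, y, summable_norms, hasSum_trace⟩ := hR.exists_hasSum_trace_comp
  refine ⟨C * ∑' i, ‖x i‖ * ‖y i‖, fun a => ?_⟩
  rw [← (hasSum_trace (T a)).tsum_eq]
  refine tsum_of_norm_bounded (summable_norms.hasSum.mul_left C) fun i =>
    (norm_inner_apply_le _ _ _).trans ?_
  gcongr
  exact hC a

theorem continuous_trace_comp (hT : IsBoundedFamily T) (hR : IsTraceClass b R) :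
    Continuous fun a => trace b (R ∘L T a) := by
  obtain ⟨C, hC⟩ := hT.exists_norm_le
  obtain ⟨x, y, summable_norms, hasSum_trace⟩ := hR.exists_hasSum_trace_comp
  simp only [← (hasSum_trace _).tsum_eq]
  refine continuous_tsum (fun i => continuous_const.inner (hT.continuous_apply (y i)))
    (summable_norms.mul_left C) fun i a => (norm_inner_apply_le _ _ _).trans ?_
  gcongr
  exact hC a

theorem trace_comp_strongIntegral [Countable ι] [MeasurableSpace X] [OpensMeasurableSpace X]
    [SecondCountableTopology X] {μ : Measure X} {k : X → ℂ} (hT : IsBoundedFamily T)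
    (hk : Integrable k μ) (hR : IsTraceClass b R) :
    trace b (R ∘L hT.strongIntegral hk) = ∫ a, k a * trace b (R ∘L T a) ∂μ := by
  obtain ⟨C, hC⟩ := hT.exists_norm_le
  obtain ⟨x, y, summable_norms, hasSum_trace⟩ := hR.exists_hasSum_trace_comp
  have norm_term_le : ∀ i a, ‖k a * ⟪x i, T a (y i)⟫_ℂ‖ ≤ ‖k a‖ * (C * (‖x i‖ * ‖y i‖)) :=
    fun i a => by
      rw [norm_mul]
      gcongr
      refine (norm_inner_apply_le _ _ _).trans ?_
      gcongr
      exact hC a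
  have integrable_term : ∀ i, Integrable (fun a => k a * ⟪x i, T a (y i)⟫_ℂ) μ := fun i => by
    simpa only [← inner_smul_right] using (hT.integrable_smul_apply hk (y i)).const_inner (x i)
  have summable_integral_norm : Summable fun i => ∫ a, ‖k a * ⟪x i, T a (y i)⟫_ℂ‖ ∂μ := by
    refine Summable.of_nonneg_of_le (fun i => by positivity) (fun i => ?_)
      ((summable_norms.mul_left C).mul_left (∫ a, ‖k a‖ ∂μ))
    rw [← integral_mul_const]
    exact integral_mono (integrable_term i).norm (hk.norm.mul_const _) (norm_term_le i)
  have hasSum_integral := hasSum_integral_of_summable_integral_norm integrable_term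
    summable_integral_norm
  simp only [← hT.inner_strongIntegral_apply hk, tsum_mul_left, (hasSum_trace _).tsum_eq]
    at hasSum_integral
  exact (hasSum_trace _).unique hasSum_integral

end IsBoundedFamily

end TraceClassOperators

section Bochner

open MeasureTheory Filter Topology

variable {M : ℕ}

theorem tendsto_integral_gaussian_mul {f : (Fin M → ℂ) → ℂ} (hf : Integrable f) :
    Tendsto (fun b : ℝ => ∫ α, gaussian b α * f α) (𝓝[≥] 0) (𝓝 (∫ α, f α)) := by
  refine tendsto_integral_filter_of_dominated_convergence (fun α => ‖f α‖)
    (.of_forall fun b => (continuous_gaussian b).aestronglyMeasurable.mul hf.1) ?_ hf.norm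
    (.of_forall fun α => ?_)
  · filter_upwards [self_mem_nhdsWithin] with b hb
    refine .of_forall fun α => ?_
    rw [norm_mul]
    exact mul_le_of_le_one_left (norm_nonneg _) (norm_gaussian_le_one hb α)
  · have continuous_integrand : Continuous fun b : ℝ => gaussian b α * f α := by
      unfold gaussian
      fun_prop
    simpa [gaussian] using (continuous_integrand.tendsto 0).mono_left nhdsWithin_le_nhds

theorem tendsto_integral_mul_comp_add_smul {E : Type*} [NormedAddCommGroup E] [NormedSpace ℝ E]
    [MeasurableSpace E] [BorelSpace E] {μ : Measure E} {k f : E → ℂ}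
    {K : ℝ} (hk : Integrable k μ) (hf : Continuous f) (hK : ∀ x, ‖f x‖ ≤ K) (ξ : E) :
    Tendsto (fun s : ℝ => ∫ η, k η * f (ξ + s • η) ∂μ) (𝓝 0) (𝓝 ((∫ η, k η ∂μ) * f ξ)) := by
  rw [← integral_mul_const]
  refine tendsto_integral_filter_of_dominated_convergence (fun η => ‖k η‖ * K)
    (.of_forall fun s => ?_) (.of_forall fun s => .of_forall fun η => ?_) (hk.norm.mul_const K)
    (.of_forall fun η => ?_)
  · exact hk.1.mul (hf.comp (by fun_prop)).aestronglyMeasurable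
  · rw [norm_mul]
    gcongr
    exact hK _
  · have continuous_integrand : Continuous fun s : ℝ => k η * f (ξ + s • η) :=
      continuous_const.mul (hf.comp (by fun_prop))
    simpa using continuous_integrand.tendsto 0

variable {R : FockSpace M →L[ℂ] FockSpace M}

theorem integral_gaussian_trace_displacedParity (hR : IsTraceClass (numberBasis M) R) {s : ℝ}
    (hs : 0 < s ^ 2) (ξ : Fin M → ℂ) :
    (2 / Real.pi : ℂ) ^ M * ∫ α, gaussian (s ^ 2) α *
        (symplecticCharacter ξ α * trace (numberBasis M) (R ∘L displacedParity α)) =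
      (1 / Real.pi : ℂ) ^ M * ∫ η, gaussian 1 η *
        trace (numberBasis M) (R ∘L displacement (ξ + s • η)) := by
  simp only [← mul_assoc (gaussian _ _),
    ← (isBoundedFamily_displacedParity M).trace_comp_strongIntegral
      (integrable_gaussian_mul_symplecticCharacter hs ξ) hR,
    ← (isBoundedFamily_displacement_add_smul ξ s).trace_comp_strongIntegral
      (integrable_gaussian one_pos) hR]
  rw [← trace_smul, ← trace_smul, ← ContinuousLinearMap.comp_smul,
    ← ContinuousLinearMap.comp_smul, strongIntegral_gaussian_displacedParity hs]

theorem trace_displacement_eq_integral (hR : IsTraceClass (numberBasis M) R)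
    (wigner_integrable : Integrable fun α => trace (numberBasis M) (R ∘L displacedParity α))
    (ξ : Fin M → ℂ) :
    trace (numberBasis M) (R ∘L displacement ξ) =
      (2 / Real.pi : ℂ) ^ M * ∫ α, symplecticCharacter ξ α *
        trace (numberBasis M) (R ∘L displacedParity α) := by
  have fourier_integrable : Integrable fun α =>
      symplecticCharacter ξ α * trace (numberBasis M) (R ∘L displacedParity α) :=
    wigner_integrable.bdd_mul (c := 1) (continuous_symplecticCharacter ξ).aestronglyMeasurable
      (.of_forall fun α => (norm_symplecticCharacter ξ α).le)
  obtain ⟨K, hK⟩ := (isBoundedFamily_displacement M).exists_norm_trace_comp_le hR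
  have sq_tendsto : Tendsto (fun s : ℝ => s ^ 2) (𝓝[≠] 0) (𝓝[≥] 0) := by
    refine tendsto_nhdsWithin_iff.2 ⟨?_, .of_forall fun s => sq_nonneg s⟩
    simpa using ((continuous_pow 2).tendsto (0 : ℝ)).mono_left nhdsWithin_le_nhds
  have parity_limit := ((tendsto_integral_gaussian_mul fourier_integrable).comp
    sq_tendsto).const_mul ((2 / Real.pi : ℂ) ^ M)
  have displacement_limit := ((tendsto_integral_mul_comp_add_smul (integrable_gaussian one_pos)
    ((isBoundedFamily_displacement M).continuous_trace_comp hR) hK ξ).mono_left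
      (nhdsWithin_le_nhds (s := {0}ᶜ))).const_mul ((1 / Real.pi : ℂ) ^ M)
  have limits_agree := tendsto_nhds_unique displacement_limit <| parity_limit.congr' <| by
    filter_upwards [self_mem_nhdsWithin] with s hs
    exact integral_gaussian_trace_displacedParity hR (sq_pos_of_ne_zero hs) ξ
  rw [← limits_agree, integral_gaussian one_pos, ← mul_assoc, ← mul_pow]
  simp [Real.pi_ne_zero]

end Bochner

section TraceNorm

open MeasureTheory InnerProductSpace

variable {E : Type*} [NormedAddCommGroup E] [InnerProductSpace ℂ E]

theorem sum_norm_inner_mul_norm_inner_le {ι : Type*} [Fintype ι] (e f : OrthonormalBasis ι ℂ E)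
    (x y : E) : ∑ i, ‖⟪f i, x⟫_ℂ‖ * ‖⟪y, e i⟫_ℂ‖ ≤ ‖x‖ * ‖y‖ := by
  have cauchy_schwarz := Real.sum_mul_le_sqrt_mul_sqrt Finset.univ
    (fun i => ‖⟪f i, x⟫_ℂ‖) (fun i => ‖⟪y, e i⟫_ℂ‖)
  simpa only [f.sum_sq_norm_inner_right, e.sum_sq_norm_inner_left,
    Real.sqrt_sq (norm_nonneg _)] using cauchy_schwarz

variable {Ω : Type*} [MeasurableSpace Ω] {μ : Measure Ω}

theorem inner_integral_rankOne_apply [CompleteSpace E] {x y : Ω → E}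
    (hxy : Integrable (fun a => rankOne ℂ (x a) (y a)) μ) (u v : E) :
    ⟪u, (∫ a, rankOne ℂ (x a) (y a) ∂μ) v⟫_ℂ = ∫ a, ⟪u, x a⟫_ℂ * ⟪y a, v⟫_ℂ ∂μ := by
  rw [ContinuousLinearMap.integral_apply hxy,
    ← integral_inner (hxy.apply_continuousLinearMap v)]
  simp only [inner_right_rankOne_apply]

variable [FiniteDimensional ℂ E] {n N : ℕ}

theorem exists_orthonormalBasis_apply_eq_singularValues_smul (hn : Module.finrank ℂ E = n)
    (T : E →ₗ[ℂ] E) :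
    ∃ e f : OrthonormalBasis (Fin n) ℂ E, ∀ i, T (e i) = (T.singularValues i : ℂ) • f i := by
  set e := T.isSymmetric_adjoint_comp_self.eigenvectorBasis hn
  have inner_image : ∀ i j,
      ⟪T (e i), T (e j)⟫_ℂ = (T.singularValues j : ℂ) ^ 2 * ⟪e i, e j⟫_ℂ := fun i j => by
    rw [← LinearMap.adjoint_inner_right, ← LinearMap.comp_apply,
      T.isSymmetric_adjoint_comp_self.apply_eigenvectorBasis, inner_smul_right,
      ← T.sq_singularValues_fin hn j]
    norm_cast
  have orthogonal_image : Pairwise fun i j => ⟪T (e i), T (e j)⟫_ℂ = 0 :=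
    fun i j hij => (inner_image i j).trans (by rw [e.orthonormal.2 hij, mul_zero])
  have norm_image : ∀ i, ‖T (e i)‖ = T.singularValues i := fun i => by
    have sq_eq := inner_image i i
    rw [inner_self_eq_norm_sq_to_K, inner_self_eq_norm_sq_to_K, e.orthonormal.1,
      RCLike.ofReal_one, one_pow, mul_one] at sq_eq
    exact (sq_eq_sq₀ (norm_nonneg _) (T.singularValues_nonneg i)).1
      (Complex.ofReal_injective (by push_cast; exact sq_eq))
  refine ⟨e, gramSchmidtOrthonormalBasis (by simpa using hn) fun i => T (e i), fun i => ?_⟩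
  by_cases hi : T (e i) = 0
  · rw [← norm_image, hi, norm_zero, Complex.ofReal_zero, zero_smul]
  · rw [gramSchmidtOrthonormalBasis_apply_of_orthogonal _ orthogonal_image hi,
      ← norm_image]
    exact (smul_inv_smul₀ (by simpa using hi) _).symm

theorem sum_singularValues_integral_rankOne_le
    (hn : Module.finrank ℂ E = n) {x y : Ω → E}
    (hxy : Integrable (fun a => rankOne ℂ (x a) (y a)) μ) :
    ∑ i : Fin n, (∫ a, rankOne ℂ (x a) (y a) ∂μ).toLinearMap.singularValues i ≤
      ∫ a, ‖x a‖ * ‖y a‖ ∂μ := by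
  set T := ∫ a, rankOne ℂ (x a) (y a) ∂μ
  obtain ⟨e, f, singular_decomposition⟩ :=
    exists_orthonormalBasis_apply_eq_singularValues_smul hn T.toLinearMap
  have integrable_inner : ∀ i, Integrable (fun a => ⟪f i, x a⟫_ℂ * ⟪y a, e i⟫_ℂ) μ := fun i => by
    simpa only [inner_right_rankOne_apply] using
      (hxy.apply_continuousLinearMap (e i)).const_inner (𝕜 := ℂ) (f i)
  have singularValue_eq : ∀ i : Fin n,
      (T.toLinearMap.singularValues i : ℂ) = ∫ a, ⟪f i, x a⟫_ℂ * ⟪y a, e i⟫_ℂ ∂μ := fun i => by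
    calc (T.toLinearMap.singularValues i : ℂ) = ⟪f i, T (e i)⟫_ℂ := by
          rw [← ContinuousLinearMap.coe_coe, singular_decomposition, inner_smul_right,
            inner_self_eq_norm_sq_to_K, f.orthonormal.1]
          simp
      _ = ∫ a, ⟪f i, x a⟫_ℂ * ⟪y a, e i⟫_ℂ ∂μ := inner_integral_rankOne_apply hxy _ _
  have singularValue_le : ∀ i : Fin n,
      T.toLinearMap.singularValues i ≤ ∫ a, ‖⟪f i, x a⟫_ℂ‖ * ‖⟪y a, e i⟫_ℂ‖ ∂μ := fun i => by
    rw [← Real.norm_of_nonneg (T.toLinearMap.singularValues_nonneg i), ← Complex.norm_real,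
      singularValue_eq]
    simpa only [norm_mul] using norm_integral_le_integral_norm
      (μ := μ) fun a => ⟪f i, x a⟫_ℂ * ⟪y a, e i⟫_ℂ
  calc ∑ i : Fin n, T.toLinearMap.singularValues i
      ≤ ∑ i, ∫ a, ‖⟪f i, x a⟫_ℂ‖ * ‖⟪y a, e i⟫_ℂ‖ ∂μ :=
        Finset.sum_le_sum fun i _ => singularValue_le i
    _ = ∫ a, ∑ i, ‖⟪f i, x a⟫_ℂ‖ * ‖⟪y a, e i⟫_ℂ‖ ∂μ :=
      (integral_finsetSum _ fun i _ => by
        simpa only [norm_mul] using (integrable_inner i).norm).symm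
    _ ≤ ∫ a, ‖x a‖ * ‖y a‖ ∂μ := by
      refine integral_mono (integrable_finsetSum _ fun i _ => by
        simpa only [norm_mul] using (integrable_inner i).norm) ?_
        fun a => sum_norm_inner_mul_norm_inner_le e f (x a) (y a)
      simpa only [norm_rankOne] using hxy.norm

theorem toEuclideanLin_eq_integral_rankOne {x y : Ω → EuclideanSpace ℂ (Fin N)}
    (hxy : Integrable (fun a => rankOne ℂ (x a) (y a)) μ) {A : Matrix (Fin N) (Fin N) ℂ}
    (hA : ∀ n n', A n n' = ∫ a, x a n * conj (y a n') ∂μ) :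
    Matrix.toEuclideanLin A = (∫ a, rankOne ℂ (x a) (y a) ∂μ).toLinearMap := by
  refine (EuclideanSpace.basisFun (Fin N) ℂ).toBasis.ext fun n' => ?_
  refine PiLp.ext fun n => ?_
  calc _ = A n n' := by simp
    _ = ∫ a, x a n * conj (y a n') ∂μ := hA n n'
    _ = ⟪EuclideanSpace.single n 1,
        (∫ a, rankOne ℂ (x a) (y a) ∂μ) (EuclideanSpace.single n' 1)⟫_ℂ := by
      simp [inner_integral_rankOne_apply hxy, EuclideanSpace.inner_single_left,
        EuclideanSpace.inner_single_right]
    _ = _ := by simp [EuclideanSpace.inner_single_left]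

theorem matrixTraceNorm_le_integral {x y : Ω → EuclideanSpace ℂ (Fin N)}
    (hxy : Integrable (fun a => rankOne ℂ (x a) (y a)) μ) {A : Matrix (Fin N) (Fin N) ℂ}
    (hA : ∀ n n', A n n' = ∫ a, x a n * conj (y a n') ∂μ) :
    matrixTraceNorm A ≤ ∫ a, ‖x a‖ * ‖y a‖ ∂μ := by
  rw [matrixTraceNorm, toEuclideanLin_eq_integral_rankOne hxy hA]
  exact sum_singularValues_integral_rankOne_le finrank_euclideanSpace_fin hxy

end TraceNorm

section CharacteristicMatrix

open MeasureTheory InnerProductSpace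

variable {M N : ℕ}

/-- The vector `(χ_{ξ₁}(α), …, χ_{ξ_N}(α))`; the matrix `C(R; Ξ)` is a weighted mean of the rank-one
projections onto these vectors. -/
noncomputable def characterVector (ξ : Fin N → Fin M → ℂ) (α : Fin M → ℂ) :
    EuclideanSpace ℂ (Fin N) :=
  WithLp.toLp 2 fun n => symplecticCharacter (ξ n) α

theorem continuous_characterVector (ξ : Fin N → Fin M → ℂ) : Continuous (characterVector ξ) :=
  (PiLp.continuous_toLp 2 _).comp (continuous_pi fun n => continuous_symplecticCharacter (ξ n))

theorem norm_sq_characterVector (ξ : Fin N → Fin M → ℂ) (α : Fin M → ℂ) :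
    ‖characterVector ξ α‖ ^ 2 = N := by
  simp [EuclideanSpace.norm_sq_eq, characterVector, norm_symplecticCharacter]

theorem integrable_rankOne_characterVector (ξ : Fin N → Fin M → ℂ) {w : (Fin M → ℂ) → ℂ}
    (hw : Integrable w) :
    Integrable fun α => rankOne ℂ (w α • characterVector ξ α) (characterVector ξ α) := by
  simp only [map_smul, smul_apply]
  have continuous_projection : Continuous fun α =>
      rankOne ℂ (characterVector ξ α) (characterVector ξ α) :=
    ((ContinuousLinearMap.toSpanSingletonCLE (𝕜 := ℂ)).continuous.comp
      (continuous_characterVector ξ)).clm_comp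
        ((innerSL ℂ).continuous.comp (continuous_characterVector ξ))
  refine hw.smul_bdd (N : ℝ) continuous_projection.aestronglyMeasurable (.of_forall fun α => ?_)
  rw [norm_rankOne, ← sq, norm_sq_characterVector]

variable {R : FockSpace M →L[ℂ] FockSpace M}

theorem characteristicMatrix_eq_integral (hR : IsTraceClass (numberBasis M) R)
    (wigner_integrable : Integrable fun α => trace (numberBasis M) (R ∘L displacedParity α))
    (ξ : Fin N → Fin M → ℂ) (n n' : Fin N) :
    characteristicMatrix R ξ n n' =
      ∫ α, (((1 / N : ℂ) * (2 / Real.pi) ^ M *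
        trace (numberBasis M) (R ∘L displacedParity α)) • characterVector ξ α) n *
        conj (characterVector ξ α n') := by
  rw [characteristicMatrix, Matrix.of_apply, trace_displacement_eq_integral hR wigner_integrable,
    ← mul_assoc, ← integral_const_mul]
  congr with α
  simp only [symplecticCharacter_sub, characterVector, PiLp.smul_apply, smul_eq_mul]
  ring

theorem matrixTraceNorm_characteristicMatrix_le (hR : IsTraceClass (numberBasis M) R)
    (wigner_integrable : Integrable fun α => trace (numberBasis M) (R ∘L displacedParity α))
    (ξ : Fin N → Fin M → ℂ) :
    matrixTraceNorm (characteristicMatrix R ξ) ≤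
      (2 / Real.pi) ^ M * ∫ α, ‖trace (numberBasis M) (R ∘L displacedParity α)‖ := by
  have norm_mul_norm_le : ∀ α,
      ‖((1 / N : ℂ) * (2 / Real.pi) ^ M * trace (numberBasis M) (R ∘L displacedParity α)) •
        characterVector ξ α‖ * ‖characterVector ξ α‖ ≤
      (2 / Real.pi) ^ M * ‖trace (numberBasis M) (R ∘L displacedParity α)‖ := fun α =>
    calc _ = (N : ℝ)⁻¹ * N * ((2 / Real.pi) ^ M *
          ‖trace (numberBasis M) (R ∘L displacedParity α)‖) := by
          rw [norm_smul, mul_assoc, ← sq, norm_sq_characterVector]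
          simp [abs_of_pos Real.pi_pos]
          ring
      _ ≤ _ := mul_le_of_le_one_left (by positivity) inv_mul_le_one
  have integrable_projections := integrable_rankOne_characterVector ξ
    (wigner_integrable.const_mul ((1 / N : ℂ) * (2 / Real.pi) ^ M))
  refine (matrixTraceNorm_le_integral integrable_projections
    (characteristicMatrix_eq_integral hR wigner_integrable ξ)).trans ?_
  rw [← integral_const_mul]
  refine integral_mono ?_ (wigner_integrable.norm.const_mul _) norm_mul_norm_le
  simpa only [norm_rankOne] using integrable_projections.norm

end CharacteristicMatrix

end BosonicModes

theorem mainTheorem1_general (M N : ℕ)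
    (R : BosonicModes.FockSpace M →L[ℂ] BosonicModes.FockSpace M)
    (hRtc : BosonicModes.IsTraceClass (BosonicModes.numberBasis M) R)
    (ξ : Fin N → Fin M → ℂ) :
    ENNReal.ofReal (BosonicModes.matrixTraceNorm (BosonicModes.characteristicMatrix R ξ)) ≤
      ENNReal.ofReal ((2 / Real.pi) ^ M) *
        ∫⁻ α : Fin M → ℂ,
          ‖BosonicModes.trace (BosonicModes.numberBasis M)
            (R ∘L BosonicModes.displacedParity α)‖ₑ := by
  have constant_pos : 0 < (2 / Real.pi) ^ M := by positivity
  by_cases wigner_top : ∫⁻ α : Fin M → ℂ, ‖BosonicModes.trace (BosonicModes.numberBasis M)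
      (R ∘L BosonicModes.displacedParity α)‖ₑ = ⊤
  · rw [wigner_top, ENNReal.mul_top (ENNReal.ofReal_pos.2 constant_pos).ne']
    exact le_top
  · have wigner_continuous : Continuous fun α => BosonicModes.trace (BosonicModes.numberBasis M)
        (R ∘L BosonicModes.displacedParity α) :=
      (BosonicModes.isBoundedFamily_displacedParity M).continuous_trace_comp hRtc
    have wigner_integrable : MeasureTheory.Integrable fun α =>
        BosonicModes.trace (BosonicModes.numberBasis M) (R ∘L BosonicModes.displacedParity α) :=
      ⟨wigner_continuous.aestronglyMeasurable, lt_top_iff_ne_top.2 wigner_top⟩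
    rw [← MeasureTheory.ofReal_integral_norm_eq_lintegral_enorm wigner_integrable,
      ← ENNReal.ofReal_mul constant_pos.le]
    exact ENNReal.ofReal_le_ofReal
      (BosonicModes.matrixTraceNorm_characteristicMatrix_le hRtc wigner_integrable ξ)

theorem mainTheorem1 (M N : ℕ)
    (R : BosonicModes.FockSpace M →L[ℂ] BosonicModes.FockSpace M)
    (hR : IsSelfAdjoint R)
    (hRtc : BosonicModes.IsTraceClass (BosonicModes.numberBasis M) R)
    (ξ : Fin N → Fin M → ℂ) :
    ENNReal.ofReal (BosonicModes.matrixTraceNorm (BosonicModes.characteristicMatrix R ξ)) ≤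
      ENNReal.ofReal ((2 / Real.pi) ^ M) *
        ∫⁻ α : Fin M → ℂ,
          ‖BosonicModes.trace (BosonicModes.numberBasis M)
            (R ∘L BosonicModes.displacedParity α)‖ₑ :=
  mainTheorem1_general M N R hRtc ξ
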